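/- For $n\ge 1$ let $G_n=(V_n,E_n)$ be the $n$-dimensional hypercube, $V_n=\{0,1\}^n$, whose edges join vertices differing in exactly one coordinate, and let $(\xi_e)_{e\in E_n}$ be independent exponential random variables of mean one. Let $T_n$ be the set of permutations $\pi=\pi_1\pi_2\cdots\pi_n$ of $\{1,\dots,n\}$. Identify $\pi\in T_n$ with the path of length $n$ from $(0,\dots,0)$ to $(1,\dots,1)$ that is at the vertex $\sum_{l\le i}e_{\pi_l}$ after $i$ steps, and denote by $[\pi]_i\in E_n$ the edge that it traverses in its $i$-th step. Fix $\varepsilon>0$ and $C>0$, and put $$A=\{j\in\{1,\dots,n\}: j\le Cn\},\qquad A'=\{j\in\{1,\dots,n\}: j\ge (1-C)n\},$$ $$T_n^{(1,n)}=\{\pi\in T_n:\ \pi_1\in A,\ \pi_n\in A'\}.$$ Then $$\lim_{n\to\infty}\mathbb P\Big(\#\Big\{\pi\in T_n^{(1,n)}:\ \sum_{i=2}^{n-1}\xi_{[\pi]_i}\le 1+\frac{\varepsilon}{3}\Big\}>0\Big)=1 .$$ -/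

import Mathlib

open MeasureTheory ProbabilityTheory Filter Topology

namespace HypercubeFPP

/-- The `n`-dimensional hypercube: the vertex set is `{0,1}^n`, and two vertices are joined by an
edge when they differ in exactly one coordinate. -/
def hypercube (n : ℕ) : SimpleGraph (Fin n → Bool) where
  Adj u v := hammingDist u v = 1
  symm := ⟨fun u v h => by rw [hammingDist_comm]; exact h⟩
  loopless := ⟨fun u h => by simp at h⟩

/-- A directed path of length `n` from `(0,…,0)` to `(1,…,1)` is a permutation `π` of the
coordinate directions; `π l` is the direction of the `l`-th step (steps and directions are numbered
from `0`). This is the vertex reached after `i` steps, i.e. the sum of the unit vectors `e_(π l)`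
over `l < i`. -/
def pathVertex {n : ℕ} (π : Equiv.Perm (Fin n)) (i : ℕ) : Fin n → Bool :=
  fun j => decide ((π.symm j : ℕ) < i)

theorem pathVertex_adj {n : ℕ} (π : Equiv.Perm (Fin n)) (i : Fin n) :
    (hypercube n).Adj (pathVertex π i) (pathVertex π (i + 1)) := by
  change hammingDist _ _ = 1
  unfold hammingDist
  rw [Finset.card_eq_one]
  refine ⟨π i, ?_⟩
  ext j
  have h : j = π i ↔ (π.symm j : ℕ) = i := by
    rw [← Fin.ext_iff, Equiv.symm_apply_eq]
  simp only [pathVertex, Finset.mem_filter, Finset.mem_univ, true_and, Finset.mem_singleton, ne_eq,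
    decide_eq_decide, h]
  omega

/-- The edge traversed by the path `π` in step `i` (steps numbered from `0`). -/
def pathEdge {n : ℕ} (π : Equiv.Perm (Fin n)) (i : Fin n) : (hypercube n).edgeSet :=
  ⟨s(pathVertex π i, pathVertex π (i + 1)), (SimpleGraph.mem_edgeSet _).2 (pathVertex_adj π i)⟩

/-- The weight of the path `π` without its first and its last edge, for the edge weights `w`. -/
noncomputable def middleWeight {n : ℕ} (w : (hypercube n).edgeSet → ℝ)
    (π : Equiv.Perm (Fin n)) : ℝ :=
  ∑ i ∈ Finset.univ.filter (fun i : Fin n => 0 < (i : ℕ) ∧ (i : ℕ) + 1 < n), w (pathEdge π i)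

/-- The directions `j ∈ {1,…,n}` with `j ≤ C n`. -/
def firstDirections (C : ℝ) (n : ℕ) : Set (Fin n) :=
  {j | ((j : ℕ) : ℝ) + 1 ≤ C * n}

/-- The directions `j ∈ {1,…,n}` with `j ≥ (1 - C) n`. -/
def lastDirections (C : ℝ) (n : ℕ) : Set (Fin n) :=
  {j | (1 - C) * n ≤ ((j : ℕ) : ℝ) + 1}

/-- The paths whose first step is in one of the first directions, and whose last step is in one of
the last directions. -/
def connectingPaths (C : ℝ) (n : ℕ) : Set (Equiv.Perm (Fin n)) :=
  {π | (∀ i : Fin n, (i : ℕ) = 0 → π i ∈ firstDirections C n) ∧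
    ∀ i : Fin n, (i : ℕ) + 1 = n → π i ∈ lastDirections C n}

end HypercubeFPP

namespace HypercubeFPP

open Finset

/-! Second moment method. Put `x = 1 + ε/3`, `m = n - 2`, and let `p` be the probability that a sum
of `m` mean-one exponentials is at most `x`; then `p ≥ exp (-x) * x ^ m / m!`. The admissible paths
number at least `c * n!` with `c > 0` fixed (`exists_mul_factorial_le_card_connectingPaths`), so it
suffices that the variance of the number of light ones is negligible against the squared mean.

Paths with no common middle edge are independent and contribute nothing. If two paths share `k`
middle edges and `r = m - k`, conditioning on the shared weight bounds their joint probability by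
`(2r).choose r * x ^ (2r + k) / (2r + k)!` (`measure_sum_le_inter_le`). A path sharing the steps `S`
with a given one may only permute the directions inside each gap of `S`, so such paths are counted
by products of gap factorials (`card_filter_subset_sharedSteps_le`).

Relative to `n!`, the sum of these products is estimated in two ways. For `k ≤ √n`, the end gaps are
nonempty because the first and last edges are left out; hence no gap takes everything, which gains a
factor of order `1/n` (`sum_prod_factorial_le_of_pos`). The remaining growth `(4/3) ^ k` is beaten
by `(2/3) ^ k` from the joint probability. For `k > √n`, the sum is polynomial in `n` times `β ^ (k
+ 1)` with `β` as close to 1 as desired (`sum_prod_factorial_le`); since `x > 1`, one takes `β < x`,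
and `(β / x) ^ √n` beats the polynomial. Summing over `k` gives a bound tending to 0. -/

/-! ### Factorial inequalities -/

theorem pow_mul_factorial_sub_le {N s : ℕ} (hs : s ≤ N) :
    (N : ℝ) ^ s * ((N - s).factorial : ℝ) ≤ 3 ^ s * (N.factorial : ℝ) := by
  -- Factor by factor, `N * (s - i) ≤ (N - i) * s`. The 3 in the statement comes from `s ^ s ≤ e ^ s
  -- * s!`.
  have h1 : N ^ s * s.factorial ≤ N.descFactorial s * s ^ s := by
    have h : s.factorial = ∏ i ∈ range s, (s - i) := by
      rw [← Nat.descFactorial_self, Nat.descFactorial_eq_prod_range]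
    have hc : ∀ c : ℕ, c ^ s = ∏ _i ∈ range s, c := fun c => by simp
    rw [h, Nat.descFactorial_eq_prod_range, hc, hc, ← prod_mul_distrib, ← prod_mul_distrib]
    refine prod_le_prod' fun i hi => ?_
    have hi := mem_range.1 hi
    obtain ⟨a, rfl⟩ := Nat.exists_eq_add_of_lt hi
    obtain ⟨b, rfl⟩ := Nat.exists_eq_add_of_le hs
    have e1 : i + a + 1 - i = a + 1 := by omega
    have e2 : i + a + 1 + b - i = a + 1 + b := by omega
    rw [e1, e2]
    nlinarith [Nat.zero_le (i * b)]
  have h2 : (s : ℝ) ^ s ≤ 3 ^ s * (s.factorial : ℝ) := by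
    have h3 := Real.pow_div_factorial_le_exp (s : ℝ) (by positivity) s
    have h4 : Real.exp (s : ℝ) ≤ 3 ^ s := by
      rw [← Real.exp_one_pow]
      exact pow_le_pow_left₀ (Real.exp_pos _).le Real.exp_one_lt_three.le _
    rw [div_le_iff₀ (by positivity)] at h3
    exact h3.trans (by gcongr)
  have h5 : (N - s).factorial * N.descFactorial s = N.factorial :=
    Nat.factorial_mul_descFactorial hs
  have h1' : (N : ℝ) ^ s * s.factorial ≤ N.descFactorial s * (s : ℝ) ^ s := by exact_mod_cast h1
  have h6 : (N : ℝ) ^ s ≤ N.descFactorial s * 3 ^ s := by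
    have : (0 : ℝ) < s.factorial := by positivity
    refine le_of_mul_le_mul_right (h1'.trans ?_) this
    calc (N.descFactorial s : ℝ) * (s : ℝ) ^ s
        ≤ N.descFactorial s * (3 ^ s * (s.factorial : ℝ)) := by gcongr
      _ = _ := by ring
  rw [← h5]
  push_cast
  calc (N : ℝ) ^ s * ((N - s).factorial : ℝ)
      ≤ (N.descFactorial s * 3 ^ s) * ((N - s).factorial : ℝ) := by gcongr
    _ = _ := by ring

theorem two_pow_mul_factorial_mul_factorial_le (s t : ℕ) :
    2 ^ s * (s.factorial * (s + t).factorial) ≤ (2 * s + t).factorial := by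
  induction s with
  | zero => simp
  | succ s ih =>
    have e1 : s + 1 + t = s + t + 1 := by ring
    have e2 : 2 * (s + 1) + t = 2 * s + t + 1 + 1 := by ring
    rw [e1, e2, Nat.factorial_succ s, Nat.factorial_succ (s + t), Nat.factorial_succ,
      Nat.factorial_succ]
    calc 2 ^ (s + 1) * ((s + 1) * s.factorial * ((s + t + 1) * (s + t).factorial))
        = (2 * (s + 1)) * ((s + t + 1) * (2 ^ s * (s.factorial * (s + t).factorial))) := by ring
      _ ≤ (2 * s + t + 1 + 1) * ((2 * s + t + 1) * (2 * s + t).factorial) := by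
        gcongr <;> omega

/-- In terms of binomials, `N.choose s ≥ N * 4 ^ (s - 1)`: equality at `s = 1`, and in this range
each further step multiplies the binomial by at least 4. The factor `N` is what makes the variance
vanish. -/
theorem four_pow_mul_factorial_mul_factorial_le {N s : ℕ} (hs : 1 ≤ s) (hN : 8 * s ≤ N) :
    N * 4 ^ s * (s.factorial * (N - s).factorial) ≤ 4 * N.factorial := by
  induction s, hs using Nat.le_induction with
  | base =>
    have : N.factorial = N * (N - 1).factorial := (Nat.mul_factorial_pred (by omega)).symm
    rw [this]; simp; apply le_of_eq; ring
  | succ s hs ih =>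
    refine le_trans ?_ (ih (by omega))
    have : N - s = (N - (s + 1)) + 1 := by omega
    rw [this, Nat.factorial_succ, Nat.factorial_succ, pow_succ]
    have hh : 4 * (s + 1) ≤ N - (s + 1) + 1 := by omega
    calc N * (4 ^ s * 4) * ((s + 1) * s.factorial * (N - (s + 1)).factorial)
        = N * 4 ^ s * s.factorial * (N - (s + 1)).factorial * (4 * (s + 1)) := by ring
      _ ≤ N * 4 ^ s * s.factorial * (N - (s + 1)).factorial * (N - (s + 1) + 1) := by gcongr
      _ = _ := by ring

/-- The quotient of the two sides is the product of `(r + i) / (2r + i)` over `1 ≤ i ≤ k`. Each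
factor is at most 1, and at most `2/3` when `i ≤ r`, which is the sharper version below. -/
theorem factorial_ratio_le (r k : ℕ) :
    (2 * r).factorial * (r + k).factorial ≤ r.factorial * (2 * r + k).factorial := by
  induction k with
  | zero => simp [mul_comm]
  | succ k ih =>
    rw [← add_assoc, ← add_assoc, Nat.factorial_succ, Nat.factorial_succ]
    calc (2 * r).factorial * ((r + k + 1) * (r + k).factorial)
        = (r + k + 1) * ((2 * r).factorial * (r + k).factorial) := by ring
      _ ≤ (2 * r + k + 1) * (r.factorial * (2 * r + k).factorial) := by gcongr; omega
      _ = _ := by ring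

theorem three_pow_mul_factorial_ratio_le {r k : ℕ} (hk : k ≤ r) :
    3 ^ k * ((2 * r).factorial * (r + k).factorial) ≤
      2 ^ k * (r.factorial * (2 * r + k).factorial) := by
  induction k with
  | zero => simp [mul_comm]
  | succ k ih =>
    rw [← add_assoc, ← add_assoc, Nat.factorial_succ, Nat.factorial_succ]
    calc 3 ^ (k + 1) * ((2 * r).factorial * ((r + k + 1) * (r + k).factorial))
        = (3 * (r + k + 1)) * (3 ^ k * ((2 * r).factorial * (r + k).factorial)) := by ring
      _ ≤ (2 * (2 * r + k + 1)) * (2 ^ k * (r.factorial * (2 * r + k).factorial)) :=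
        Nat.mul_le_mul (by omega) (ih (by omega))
      _ = _ := by ring

/-! ### Sums of products of gap factorials -/

/-- Small parts, of total size `s`, satisfy `(g j)! ≤ (N / q) ^ g j`; the large parts together give
at most `(N - s)!`. Then `N ^ s * (N - s)!` is absorbed into `3 ^ s * N!`. -/
theorem prod_factorial_le {ι : Type*} [Fintype ι] {q N : ℕ} (hq : 0 < q) (g : ι → ℕ)
    (hg : ∑ j, g j = N) :
    ∏ j, ((g j).factorial : ℝ) ≤
      N.factorial * ∏ j, (if q * g j ≤ N then (3 / q : ℝ) ^ g j else 1) := by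
  classical
  set J := univ.filter fun j => q * g j ≤ N with hJ
  set s := ∑ j ∈ J, g j with hs
  have hsum : s + ∑ j ∈ univ.filter (fun j => ¬ q * g j ≤ N), g j = N := by
    rw [hs, hJ, Finset.sum_filter_add_sum_filter_not, hg]
  have hsN : s ≤ N := by omega
  rw [← Finset.prod_filter_mul_prod_filter_not univ (fun j => q * g j ≤ N), prod_ite,
    prod_const_one, mul_one, prod_pow_eq_pow_sum, ← hJ, ← hs]
  have h1 : ∏ j ∈ J, ((g j).factorial : ℝ) ≤ (N / q : ℝ) ^ s := by
    rw [hs, ← prod_pow_eq_pow_sum]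
    refine prod_le_prod (fun _ _ => by positivity) fun j hj => ?_
    have h : (q * g j : ℝ) ≤ N := by exact_mod_cast (mem_filter.1 hj).2
    calc ((g j).factorial : ℝ) ≤ (g j : ℝ) ^ g j := by exact_mod_cast Nat.factorial_le_pow (g j)
      _ ≤ _ := by
        gcongr
        rw [le_div_iff₀ (by positivity)]
        linarith
  have h2 : ∏ j ∈ univ.filter (fun j => ¬ q * g j ≤ N), ((g j).factorial : ℝ) ≤
      ((N - s).factorial : ℝ) := by
    have := Nat.le_of_dvd (Nat.factorial_pos _)
      (Nat.prod_factorial_dvd_factorial_sum (univ.filter (fun j => ¬ q * g j ≤ N)) g)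
    have e : ∑ j ∈ univ.filter (fun j => ¬ q * g j ≤ N), g j = N - s := by omega
    rw [e] at this
    exact_mod_cast this
  calc _ ≤ (N / q : ℝ) ^ s * ((N - s).factorial : ℝ) := by gcongr
    _ = (1 / q) ^ s * ((N : ℝ) ^ s * ((N - s).factorial : ℝ)) := by
      rw [div_pow, div_pow]; ring
    _ ≤ (1 / q) ^ s * (3 ^ s * (N.factorial : ℝ)) :=
      mul_le_mul_of_nonneg_left (pow_mul_factorial_sub_le hsN) (by positivity)
    _ = _ := by rw [div_pow, div_pow]; ring

/-- The possible sizes of the `k + 1` gaps between `k` steps, when `N` steps are left over and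
the first and the last gap are not empty. -/
def gapTuples (k N : ℕ) : Finset (Fin (k + 1) → ℕ) :=
  (Fintype.piFinset fun _ => range (N + 1)).filter
    fun g => ∑ j, g j = N ∧ 1 ≤ g 0 ∧ 1 ≤ g (Fin.last k)

theorem sum_geometric_le {y : ℝ} (h0 : 0 ≤ y) (h1 : y < 1) (N : ℕ) :
    ∑ i ∈ range N, y ^ i ≤ (1 - y)⁻¹ := by
  rw [← tsum_geometric_of_lt_one h0 h1]
  exact (summable_geometric_of_lt_one h0 h1).sum_le_tsum _ fun _ _ => by positivity

/-- At most `q` gaps exceed `N / q`. Giving each of them an artificial weight `z = δ / (N + 1)`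
costs at most `z⁻¹ ^ q` overall and makes the sum factor over the gaps; each gap then contributes a
geometric series plus at most `(N + 1) * z = δ`. -/
theorem sum_prod_factorial_le {k N q : ℕ} (hq : 3 < q) {δ : ℝ} (h0 : 0 < δ) (h1 : δ ≤ 1) :
    ∑ g ∈ gapTuples k N, ∏ j, ((g j).factorial : ℝ) ≤
      N.factorial * (((N + 1) / δ) ^ q * ((1 - 3 / q : ℝ)⁻¹ + δ) ^ (k + 1)) := by
  set z : ℝ := δ / (N + 1) with hz
  have hz0 : 0 < z := by positivity
  have hz1 : z ≤ 1 := by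
    rw [hz, div_le_one (by positivity)]; linarith [(Nat.cast_nonneg N : (0 : ℝ) ≤ N)]
  have hq0 : (3 : ℝ) < q := by exact_mod_cast hq
  have hy0 : (0 : ℝ) ≤ 3 / q := by positivity
  have hy1 : (3 / q : ℝ) < 1 := by rw [div_lt_one (by linarith)]; exact hq0
  have hzi : ((N + 1) / δ : ℝ) = z⁻¹ := by rw [hz, inv_div]
  have key : ∀ g ∈ gapTuples k N, ∏ j, ((g j).factorial : ℝ) ≤
      N.factorial * (z⁻¹ ^ q * ∏ j, (if q * g j ≤ N then (3 / q : ℝ) ^ g j else z)) := by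
    intro g hg
    obtain ⟨-, hsum, -⟩ := mem_filter.1 hg
    refine (prod_factorial_le (q := q) (by omega) g hsum).trans ?_
    refine mul_le_mul_of_nonneg_left ?_ (by positivity)
    set B := univ.filter fun j => ¬ q * g j ≤ N with hB
    have hcard : #B ≤ q := by
      by_contra! hlt
      have h3 : #B * (N + 1) ≤ ∑ j ∈ B, q * g j := by
        rw [← smul_eq_mul]
        exact card_nsmul_le_sum _ _ _ fun j hj => by
          exact Nat.succ_le_of_lt (not_le.1 (mem_filter.1 hj).2)
      have h4 : ∑ j ∈ B, q * g j ≤ q * N := by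
        rw [← mul_sum, ← hsum]
        exact Nat.mul_le_mul_left _ (sum_le_sum_of_subset (filter_subset _ _))
      nlinarith
    rw [prod_ite, prod_ite, prod_const_one, mul_one, prod_const, ← hB]
    have : 1 ≤ z⁻¹ ^ q * z ^ #B := by
      rw [inv_pow, ← div_eq_inv_mul, one_le_div (by positivity)]
      exact pow_le_pow_of_le_one hz0.le hz1 hcard
    have h5 : 0 ≤ ∏ x with q * g x ≤ N, (3 / q : ℝ) ^ g x := prod_nonneg fun _ _ => by positivity
    rw [mul_left_comm]
    exact le_mul_of_one_le_right h5 this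
  refine (sum_le_sum key).trans ?_
  rw [← mul_sum, ← mul_sum, hzi]
  gcongr
  calc ∑ g ∈ gapTuples k N, ∏ j, (if q * g j ≤ N then (3 / q : ℝ) ^ g j else z)
      ≤ ∑ g ∈ Fintype.piFinset fun _ : Fin (k + 1) => range (N + 1),
          ∏ j, (if q * g j ≤ N then (3 / q : ℝ) ^ g j else z) := by
        refine sum_le_sum_of_subset_of_nonneg (filter_subset _ _) fun g _ _ => ?_
        exact prod_nonneg fun j _ => by split_ifs <;> positivity
    _ = (∑ i ∈ range (N + 1), (if q * i ≤ N then (3 / q : ℝ) ^ i else z)) ^ (k + 1) := by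
        rw [← prod_univ_sum (fun _ : Fin (k + 1) => range (N + 1))
          (fun _ i => if q * i ≤ N then (3 / q : ℝ) ^ i else z)]
        simp
    _ ≤ _ := by
        refine pow_le_pow_left₀ (sum_nonneg fun i _ => by split_ifs <;> positivity) ?_ _
        calc ∑ i ∈ range (N + 1), (if q * i ≤ N then (3 / q : ℝ) ^ i else z)
            ≤ ∑ i ∈ range (N + 1), ((3 / q : ℝ) ^ i + z) := by
              refine sum_le_sum fun i _ => ?_
              have : 0 ≤ (3 / q : ℝ) ^ i := by positivity
              split_ifs <;> linarith
          _ = ∑ i ∈ range (N + 1), (3 / q : ℝ) ^ i + δ := by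
              rw [sum_add_distrib]
              simp only [sum_const, card_range, nsmul_eq_mul, hz]
              push_cast
              field_simp
          _ ≤ _ := by
              have := sum_geometric_le hy0 hy1 (N + 1)
              linarith

theorem prod_factorial_le_of_large {k N : ℕ} (hk : 1 ≤ k) {g : Fin (k + 1) → ℕ}
    (hg : g ∈ gapTuples k N) {j : Fin (k + 1)} (hj : 7 * N ≤ 8 * g j) :
    ∏ i, ((g i).factorial : ℝ) ≤
      N.factorial * (4 / N * ∏ i : Fin k, (1 / 4 : ℝ) ^ g (j.succAbove i)) := by
  obtain ⟨-, hsum, h0, hl⟩ := mem_filter.1 hg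
  set s := ∑ i : Fin k, g (j.succAbove i) with hs
  have hsN : g j + s = N := by rw [← hsum, Fin.sum_univ_succAbove g j]
  -- Since `k ≥ 1`, the first and last gaps are distinct, and at least one of them is not the
  -- dominant gap `j`.
  have hs1 : 1 ≤ s := by
    have : ∃ i, i ≠ j ∧ 1 ≤ g i := by
      by_cases hj0 : j = 0
      · refine ⟨Fin.last k, ?_, hl⟩
        rw [hj0, Ne, Fin.last_eq_zero_iff]; omega
      · exact ⟨0, fun h => hj0 h.symm, h0⟩
    obtain ⟨i, hij, hi⟩ := this
    obtain ⟨i', rfl⟩ := Fin.exists_succAbove_eq hij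
    exact hi.trans (single_le_sum (f := fun i => g (j.succAbove i)) (fun _ _ => Nat.zero_le _)
      (mem_univ i'))
  have h1 := four_pow_mul_factorial_mul_factorial_le hs1 (N := N) (by omega)
  have h2 : ∏ i : Fin k, (g (j.succAbove i)).factorial ≤ s.factorial :=
    Nat.le_of_dvd (Nat.factorial_pos _) (Nat.prod_factorial_dvd_factorial_sum _ _)
  have h1' : (N : ℝ) * 4 ^ s * (s.factorial * (N - s).factorial) ≤ 4 * N.factorial := by
    exact_mod_cast h1
  have h2' : ∏ i : Fin k, ((g (j.succAbove i)).factorial : ℝ) ≤ s.factorial := by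
    exact_mod_cast h2
  have hN : (0 : ℝ) < N := by
    have : 0 < N := by omega
    exact_mod_cast this
  rw [Fin.prod_univ_succAbove _ j, prod_pow_eq_pow_sum, ← hs]
  have e : g j = N - s := by omega
  rw [e]
  calc ((N - s).factorial : ℝ) * ∏ i : Fin k, ((g (j.succAbove i)).factorial : ℝ)
      ≤ (N - s).factorial * s.factorial := by gcongr
    _ = (N : ℝ) * 4 ^ s * (s.factorial * (N - s).factorial) / (N * 4 ^ s) := by field_simp
    _ ≤ 4 * N.factorial / (N * 4 ^ s) := by gcongr
    _ = _ := by rw [div_pow, one_pow]; field_simp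

/-- Either all gaps are at most `N / 8`, which yields `(3/8) ^ N`, or some gap lies strictly between
`N / 8` and `7N / 8`, and splitting it off gains a binomial coefficient of size at least `2 ^ (N /
8)`. -/
theorem prod_factorial_le_of_small {k N : ℕ} {g : Fin (k + 1) → ℕ}
    (hsum : ∑ j, g j = N) (hj : ∀ j, 8 * g j < 7 * N) :
    ∏ i, ((g i).factorial : ℝ) ≤ N.factorial * (1 / 2) ^ (N / 8) := by
  by_cases h : ∀ j, 8 * g j ≤ N
  · refine (prod_factorial_le (q := 8) (by norm_num) g hsum).trans ?_
    simp only [h, if_true]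
    rw [prod_pow_eq_pow_sum, hsum]
    gcongr ?_ * ?_
    calc ((3 / (8 : ℕ) : ℝ)) ^ N ≤ (1 / 2) ^ N := 
        pow_le_pow_left₀ (by norm_num) (by norm_num) _
      _ ≤ _ := pow_le_pow_of_le_one (by norm_num) (by norm_num) (Nat.div_le_self _ _)
  · push Not at h
    obtain ⟨j, hj1⟩ := h
    have hj2 := hj j
    set s := ∑ i : Fin k, g (j.succAbove i) with hs
    have hsN : g j + s = N := by rw [← hsum, Fin.sum_univ_succAbove g j]
    have h2 : ∏ i : Fin k, (g (j.succAbove i)).factorial ≤ s.factorial :=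
      Nat.le_of_dvd (Nat.factorial_pos _) (Nat.prod_factorial_dvd_factorial_sum _ _)
    have h3 : 2 ^ (N / 8) * ((g j).factorial * s.factorial) ≤ N.factorial := by
      rcases le_total (g j) s with hle | hle
      · obtain ⟨t, ht⟩ := Nat.exists_eq_add_of_le hle
        have := two_pow_mul_factorial_mul_factorial_le (g j) t
        rw [← ht, show 2 * g j + t = N by omega] at this
        refine le_trans (Nat.mul_le_mul_right _ (Nat.pow_le_pow_right (by norm_num) ?_)) this
        omega
      · obtain ⟨t, ht⟩ := Nat.exists_eq_add_of_le hle
        have := two_pow_mul_factorial_mul_factorial_le s t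
        rw [← ht, show 2 * s + t = N by omega, mul_comm s.factorial] at this
        refine le_trans (Nat.mul_le_mul_right _ (Nat.pow_le_pow_right (by norm_num) ?_)) this
        omega
    have h4 : 2 ^ (N / 8) * ∏ i, (g i).factorial ≤ N.factorial := by
      rw [Fin.prod_univ_succAbove _ j]
      exact le_trans (by gcongr) h3
    have h4' : (2 : ℝ) ^ (N / 8) * ∏ i, ((g i).factorial : ℝ) ≤ N.factorial := by
      exact_mod_cast h4
    rw [div_pow, one_pow, ← div_eq_mul_one_div, le_div_iff₀ (by positivity)]
    linarith

/-- The dominant gap can be in `k + 1` places and is determined by the other gaps, each of which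
sums to at most `∑ (1/4) ^ i ≤ 4/3`. Tuples without a dominant gap are exponentially light, so
counting them crudely is enough. -/
theorem sum_prod_factorial_le_of_pos {k N : ℕ} (hk : 1 ≤ k) :
    ∑ g ∈ gapTuples k N, ∏ j, ((g j).factorial : ℝ) ≤
      N.factorial * ((k + 1) * (4 / N) * (4 / 3 : ℝ) ^ k +
        (N + 1) ^ (k + 1) * (1 / 2 : ℝ) ^ (N / 8)) := by
  have key : ∀ g ∈ gapTuples k N, ∏ j, ((g j).factorial : ℝ) ≤
      N.factorial * (∑ j, 4 / N * ∏ i : Fin k, (1 / 4 : ℝ) ^ g (Fin.succAbove j i)) +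
        N.factorial * (1 / 2 : ℝ) ^ (N / 8) := by
    intro g hg
    by_cases h : ∃ j, 7 * N ≤ 8 * g j
    · obtain ⟨j, hj⟩ := h
      have h1 := prod_factorial_le_of_large hk hg hj
      have h2 : 4 / N * ∏ i : Fin k, (1 / 4 : ℝ) ^ g (Fin.succAbove j i) ≤
          ∑ j, 4 / N * ∏ i : Fin k, (1 / 4 : ℝ) ^ g (Fin.succAbove j i) :=
        single_le_sum (f := fun j => 4 / N * ∏ i : Fin k, (1 / 4 : ℝ) ^ g (Fin.succAbove j i))
          (fun _ _ => mul_nonneg (by positivity) (prod_nonneg fun _ _ => by positivity))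
          (mem_univ j)
      have h3 : (0 : ℝ) ≤ N.factorial * (1 / 2 : ℝ) ^ (N / 8) := by positivity
      have h4 := mul_le_mul_of_nonneg_left h2 (Nat.cast_nonneg (α := ℝ) N.factorial)
      linarith
    · push Not at h
      have h1 := prod_factorial_le_of_small (mem_filter.1 hg).2.1 h
      have h2 : (0 : ℝ) ≤ N.factorial *
          (∑ j, 4 / N * ∏ i : Fin k, (1 / 4 : ℝ) ^ g (Fin.succAbove j i)) :=
        mul_nonneg (by positivity) (sum_nonneg fun _ _ =>
          mul_nonneg (by positivity) (prod_nonneg fun _ _ => by positivity))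
      linarith
  refine (sum_le_sum key).trans ?_
  rw [sum_add_distrib, ← mul_sum, sum_comm, sum_const, nsmul_eq_mul, mul_add]
  have hcard : (#(gapTuples k N) : ℝ) ≤ (N + 1) ^ (k + 1) := by
    have : #(gapTuples k N) ≤ (N + 1) ^ (k + 1) := by
      refine (card_filter_le _ _).trans ?_
      simp
    exact_mod_cast this
  have hj : ∀ j : Fin (k + 1), ∑ g ∈ gapTuples k N,
      4 / N * ∏ i : Fin k, (1 / 4 : ℝ) ^ g (j.succAbove i) ≤ 4 / N * (4 / 3 : ℝ) ^ k := by
    intro j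
    rw [← mul_sum]
    gcongr
    have hinj : Set.InjOn (fun (g : Fin (k + 1) → ℕ) (i : Fin k) => g (j.succAbove i))
        (gapTuples k N : Set (Fin (k + 1) → ℕ)) := by
      intro g hg g' hg' h
      have h1 := (mem_filter.1 (mem_coe.1 hg)).2.1
      have h2 := (mem_filter.1 (mem_coe.1 hg')).2.1
      rw [Fin.sum_univ_succAbove _ j] at h1 h2
      have h' : ∀ i, g (j.succAbove i) = g' (j.succAbove i) := fun i => congrFun h i
      simp only [h'] at h1
      funext i
      rcases Fin.eq_self_or_eq_succAbove j i with rfl | ⟨i, rfl⟩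
      · omega
      · exact h' i
    rw [← sum_image (s := gapTuples k N)
      (g := fun (g : Fin (k + 1) → ℕ) (i : Fin k) => g (j.succAbove i))
      (f := fun g => ∏ i, (1 / 4 : ℝ) ^ g i) hinj]
    calc _ ≤ ∑ g ∈ Fintype.piFinset fun _ : Fin k => range (N + 1), ∏ i, (1 / 4 : ℝ) ^ g i := by
          refine sum_le_sum_of_subset_of_nonneg ?_ fun g _ _ =>
            prod_nonneg fun _ _ => by positivity
          intro g hg
          obtain ⟨g', hg', rfl⟩ := mem_image.1 hg
          have := (mem_filter.1 hg').1
          rw [Fintype.mem_piFinset] at this ⊢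
          exact fun i => this _
      _ = (∑ i ∈ range (N + 1), (1 / 4 : ℝ) ^ i) ^ k := by
          rw [← prod_univ_sum (fun _ : Fin k => range (N + 1)) (fun _ i => (1 / 4 : ℝ) ^ i)]
          simp
      _ ≤ _ := by
          gcongr
          refine (sum_geometric_le (by norm_num) (by norm_num) _).trans ?_
          norm_num
  refine add_le_add ?_ ?_
  · refine mul_le_mul_of_nonneg_left ?_ (by positivity)
    refine (sum_le_sum fun j _ => hj j).trans ?_
    simp [mul_assoc]
  · calc _ ≤ (N + 1 : ℝ) ^ (k + 1) * (N.factorial * (1 / 2 : ℝ) ^ (N / 8)) := by gcongr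
      _ = _ := by ring

/-! ### Shared edges and the gaps between them -/

theorem card_pathVertex {n : ℕ} (π : Equiv.Perm (Fin n)) {i : ℕ} (hi : i ≤ n) :
    #(univ.filter fun j => pathVertex π i j = true) = i := by
  have h : univ.filter (fun j => pathVertex π i j = true) =
      (univ.filter fun l : Fin n => (l : ℕ) < i).map π.toEmbedding := by
    ext j
    simp only [pathVertex, decide_eq_true_eq, mem_filter, mem_univ, true_and, mem_map_equiv]
  rw [h, card_map, Fin.card_filter_val_lt, min_eq_right hi]

/-- The vertex after `i` steps has exactly `i` ones, so an edge reveals the step in which it is used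
and its orientation. -/
theorem pathEdge_eq {n : ℕ} {π π' : Equiv.Perm (Fin n)} {i j : Fin n}
    (h : pathEdge π i = pathEdge π' j) :
    i = j ∧ pathVertex π i = pathVertex π' i ∧ pathVertex π (i + 1) = pathVertex π' (i + 1) := by
  have h1 := congrArg Subtype.val h
  simp only [pathEdge] at h1
  have hi := i.2
  have hj := j.2
  have card : ∀ {a b : ℕ}, a ≤ n → b ≤ n → pathVertex π a = pathVertex π' b → a = b := by
    intro a b ha hb hab
    rw [← card_pathVertex π ha, ← card_pathVertex π' hb, hab]
  rw [Sym2.eq_iff] at h1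
  rcases h1 with ⟨h1, h2⟩ | ⟨h1, h2⟩
  · have := card (by omega) (by omega) h1
    obtain rfl := Fin.ext this
    exact ⟨rfl, h1, h2⟩
  · have h3 := card (by omega) (by omega) h1
    have h4 := card (by omega) (by omega) h2
    omega

/-- The steps of a path other than the first and the last one. -/
def middleSteps (n : ℕ) : Finset (Fin n) :=
  univ.filter fun i => 0 < (i : ℕ) ∧ (i : ℕ) + 1 < n

theorem card_middleSteps (n : ℕ) : #(middleSteps n) = n - 2 := by
  have h : (middleSteps n).map Fin.valEmbedding = Ioo 0 (n - 1) := by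
    ext a
    simp only [middleSteps, Finset.mem_map, mem_filter, mem_univ, true_and, Fin.valEmbedding_apply,
      mem_Ioo]
    constructor
    · rintro ⟨i, hi, rfl⟩
      omega
    · intro ha
      exact ⟨⟨a, by omega⟩, by simp only; omega, rfl⟩
  rw [← card_map, h, Nat.card_Ioo]
  omega

open Classical in
/-- The edges that a path traverses, without the first and the last one. -/
noncomputable def middleEdges {n : ℕ} (π : Equiv.Perm (Fin n)) : Finset (hypercube n).edgeSet :=
  (middleSteps n).image (pathEdge π)

open Classical in
/-- The steps, other than the first and the last one, in which two paths traverse the same edge. -/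
noncomputable def sharedSteps {n : ℕ} (π π' : Equiv.Perm (Fin n)) : Finset (Fin n) :=
  (middleSteps n).filter fun i => pathEdge π i = pathEdge π' i

theorem pathEdge_injective {n : ℕ} (π : Equiv.Perm (Fin n)) : Function.Injective (pathEdge π) :=
  fun _ _ h => (pathEdge_eq h).1

theorem card_middleEdges {n : ℕ} (π : Equiv.Perm (Fin n)) : #(middleEdges π) = n - 2 := by
  rw [middleEdges, card_image_of_injective _ (pathEdge_injective π), card_middleSteps]

theorem middleWeight_eq {n : ℕ} (w : (hypercube n).edgeSet → ℝ) (π : Equiv.Perm (Fin n)) :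
    middleWeight w π = ∑ e ∈ middleEdges π, w e := by
  rw [middleEdges, sum_image fun _ _ _ _ h => pathEdge_injective π h]
  rfl

open Classical in
theorem card_middleEdges_inter {n : ℕ} (π π' : Equiv.Perm (Fin n)) :
    #(middleEdges π ∩ middleEdges π') = #(sharedSteps π π') := by
  have h : middleEdges π ∩ middleEdges π' = (sharedSteps π π').image (pathEdge π) := by
    ext e
    simp only [middleEdges, sharedSteps, mem_inter, mem_image, mem_filter]
    constructor
    · rintro ⟨⟨i, hi, rfl⟩, j, -, h⟩
      obtain rfl := (pathEdge_eq h).1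
      exact ⟨j, ⟨hi, h.symm⟩, rfl⟩
    · rintro ⟨i, ⟨hi, h⟩, rfl⟩
      exact ⟨⟨i, hi, rfl⟩, i, hi, h.symm⟩
  rw [h, card_image_of_injective _ (pathEdge_injective π)]

/-- The number of elements outside `S` that have exactly `j` elements of `S` below them. -/
def gapSize {n : ℕ} (S : Finset (Fin n)) (j : ℕ) : ℕ :=
  #(univ.filter fun l => l ∉ S ∧ #(S.filter (· < l)) = j)

theorem card_filter_lt_le {n : ℕ} (S : Finset (Fin n)) (l : Fin n) : #(S.filter (· < l)) ≤ #S :=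
  card_filter_le _ _

theorem card_filter_lt_lt {n : ℕ} {S : Finset (Fin n)} {l l' : Fin n} (hl : l ∈ S) (h : l < l') :
    #(S.filter (· < l)) < #(S.filter (· < l')) := by
  refine card_lt_card ((ssubset_iff_of_subset ?_).2 ⟨l, ?_, ?_⟩)
  · intro i hi
    simp only [mem_filter] at hi ⊢
    exact ⟨hi.1, hi.2.trans h⟩
  · simp [hl, h]
  · simp

/-- Consider the first position `l` where the sets differ, say `l ∈ S`. The gap of `S` that ends at
`l` is contained in the gap of `S'` with the same index, which also contains `l` and is therefore
strictly larger. -/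
theorem eq_of_gapSize_eq {n k : ℕ} {S S' : Finset (Fin n)} (hS : #S = k) (hS' : #S' = k)
    (h : ∀ j : Fin (k + 1), gapSize S j = gapSize S' j) : S = S' := by
  have key : ∀ {S S' : Finset (Fin n)}, #S = k →
      (∀ j : Fin (k + 1), gapSize S j = gapSize S' j) → ∀ l, (∀ l' < l, l' ∈ S ↔ l' ∈ S') →
      l ∈ S → l ∈ S' := by
    intro S S' hS h l ih hl
    by_contra hl'
    have hlt : ∀ a ≤ l, S.filter (· < a) = S'.filter (· < a) := by
      intro a ha
      ext b
      simp only [mem_filter]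
      constructor
      · rintro ⟨hb, hba⟩
        exact ⟨(ih b (hba.trans_le ha)).1 hb, hba⟩
      · rintro ⟨hb, hba⟩
        exact ⟨(ih b (hba.trans_le ha)).2 hb, hba⟩
    have hj := h ⟨#(S.filter (· < l)), by have := card_filter_lt_le S l; omega⟩
    refine hj.not_lt (card_lt_card ((ssubset_iff_of_subset ?_).2 ⟨l, ?_, ?_⟩))
    · intro a ha
      simp only [mem_filter, mem_univ, true_and] at ha ⊢
      have hal : a < l := by
        by_contra! hla
        rcases hla.lt_or_eq with hla | rfl
        · have := card_filter_lt_lt hl hla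
          omega
        · exact ha.1 hl
      exact ⟨fun h => ha.1 ((ih a hal).2 h), by rw [← hlt a hal.le]; exact ha.2⟩
    · simp [hl', hlt l le_rfl]
    · simp [hl]
  have : ∀ m : ℕ, ∀ l : Fin n, (l : ℕ) = m → (l ∈ S ↔ l ∈ S') := by
    intro m
    induction m using Nat.strong_induction_on with
    | _ m ih =>
      rintro l rfl
      have ih' : ∀ l' < l, l' ∈ S ↔ l' ∈ S' := fun l' hl' => ih l' hl' l' rfl
      exact ⟨key hS h l ih', key hS' (fun j => (h j).symm) l fun l' hl' => (ih' l' hl').symm⟩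
  ext l
  exact this l l rfl

theorem gapSize_mem_gapTuples {n k : ℕ} {S : Finset (Fin n)} (hS : #S = k) (hn : 2 ≤ n)
    (hmid : S ⊆ middleSteps n) : (fun j : Fin (k + 1) => gapSize S j) ∈ gapTuples k (n - k) := by
  have hsum : ∑ j : Fin (k + 1), gapSize S j = n - k := by
    have h1 : #(Sᶜ) = n - k := by rw [card_compl, Fintype.card_fin, hS]
    rw [← h1, card_eq_sum_card_fiberwise (f := fun l => #(S.filter (· < l)))
      (t := range (k + 1)), ← Fin.sum_univ_eq_sum_range]
    · refine sum_congr rfl fun j _ => ?_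
      rw [gapSize]
      congr 1
      ext l
      simp
    · intro l _
      have := card_filter_lt_le S l
      simp only [coe_range, Set.mem_Iio]
      omega
  simp only [gapTuples, mem_filter, Fintype.mem_piFinset, mem_range]
  refine ⟨fun j => ?_, hsum, ?_, ?_⟩
  · rw [← hsum, Nat.lt_succ_iff]
    exact single_le_sum (f := fun j : Fin (k + 1) => gapSize S j) (fun _ _ => Nat.zero_le _)
      (mem_univ j)
  · refine card_pos.2 ⟨⟨0, by omega⟩, ?_⟩
    simp only [mem_filter, mem_univ, true_and]
    refine ⟨fun h => ?_, ?_⟩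
    · have := (mem_filter.1 (hmid h)).2.1
      simp at this
    · rw [Fin.val_zero, card_eq_zero]
      refine filter_eq_empty_iff.2 fun {a} _ h => ?_
      rw [Fin.lt_def] at h
      simp at h
  · refine card_pos.2 ⟨⟨n - 1, by omega⟩, ?_⟩
    simp only [mem_filter, mem_univ, true_and]
    refine ⟨fun h => ?_, ?_⟩
    · have := (mem_filter.1 (hmid h)).2.2
      simp only at this
      omega
    · rw [Fin.val_last, ← hS]
      congr 1
      refine filter_true_of_mem fun a ha => ?_
      have := (mem_filter.1 (hmid ha)).2.2
      rw [Fin.lt_def]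
      simp only
      omega

-- If `π'` shares the steps `S` with `π`, both have visited the same directions before and after
-- each of these steps. So `π'⁻¹ ∘ π` fixes `S` pointwise and preserves every gap; it lies in the
-- stabilizer of the colouring `f` below, whose order is a product of factorials of fibre sizes.
open Classical in
theorem card_filter_subset_sharedSteps_le {n k : ℕ} (π : Equiv.Perm (Fin n))
    {S : Finset (Fin n)} (hS : #S = k) :
    #(univ.filter fun π' => S ⊆ sharedSteps π π') ≤ ∏ j : Fin (k + 1), (gapSize S j).factorial := by
  have hlt : ∀ l : Fin n, #(S.filter (· < l)) < k + 1 := fun l => by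
    have := card_filter_lt_le S l
    omega
  let f : Fin n → Fin (k + 1) × Bool := fun l => (⟨#(S.filter (· < l)), hlt l⟩, decide (l ∈ S))
  have hcard := DomMulAct.stabilizer_card f
  have hprod : ∏ i, (Fintype.card {a // f a = i}).factorial =
      ∏ j : Fin (k + 1), (gapSize S j).factorial := by
    rw [Fintype.prod_prod_type]
    refine prod_congr rfl fun j _ => ?_
    rw [Fintype.prod_bool]
    have h1 : (Fintype.card {a // f a = (j, true)}).factorial = 1 := by
      rw [Nat.factorial_eq_one, Fintype.card_le_one_iff]
      rintro ⟨a, ha⟩ ⟨b, hb⟩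
      simp only [f, Prod.mk.injEq, decide_eq_true_eq, Fin.ext_iff] at ha hb
      rw [Subtype.mk.injEq]
      rcases lt_trichotomy a b with h | h | h
      · have := card_filter_lt_lt ha.2 h
        omega
      · exact h
      · have := card_filter_lt_lt hb.2 h
        omega
    rw [h1, one_mul, Fintype.card_subtype, gapSize]
    congr 2
    ext a
    simp [f, Fin.ext_iff, and_comm]
  rw [← hprod, ← hcard, Fintype.card_subtype]
  refine card_le_card_of_injOn (fun π' => π.trans π'.symm) ?_ ?_
  · intro π' hπ'
    simp only [coe_filter, mem_univ, true_and, Set.mem_ofPred_eq] at hπ' ⊢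
    have hv : ∀ i ∈ S, ∀ l : Fin n,
        ((π'.symm (π l) : ℕ) < i ↔ (l : ℕ) < i) ∧
        ((π'.symm (π l) : ℕ) < i + 1 ↔ (l : ℕ) < i + 1) := by
      intro i hi l
      obtain ⟨-, h1, h2⟩ := pathEdge_eq (mem_filter.1 (hπ' hi)).2
      have h1 := congrFun h1 (π l)
      have h2 := congrFun h2 (π l)
      simp only [pathVertex, Equiv.symm_apply_apply, decide_eq_decide] at h1 h2
      exact ⟨h1.symm, h2.symm⟩
    funext l
    simp only [f, Function.comp, Equiv.trans_apply, Prod.mk.injEq, Fin.mk.injEq, decide_eq_decide]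
    refine ⟨?_, ?_⟩
    · congr 1
      refine filter_congr fun i hi => ?_
      have := (hv i hi l).2
      rw [Fin.lt_def, Fin.lt_def]
      omega
    · constructor
      · intro h
        have := hv _ h l
        have : l = π'.symm (π l) := Fin.ext (by omega)
        rwa [← this] at h
      · intro h
        have := hv _ h l
        have : π'.symm (π l) = l := Fin.ext (by omega)
        rwa [this]
  · intro π₁ _ π₂ _ h
    have h' : ∀ l, π₁.symm (π l) = π₂.symm (π l) := fun l => Equiv.congr_fun h l
    have : π₁.symm = π₂.symm := by
      ext1 j
      have := h' (π.symm j)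
      rwa [Equiv.apply_symm_apply] at this
    exact Equiv.symm_bijective.1 this

theorem sum_prod_gapSize_le {n k : ℕ} (hn : 2 ≤ n) :
    ∑ S ∈ (middleSteps n).powersetCard k, ∏ j : Fin (k + 1), ((gapSize S j).factorial : ℝ) ≤
      ∑ g ∈ gapTuples k (n - k), ∏ j, ((g j).factorial : ℝ) := by
  have hinj : Set.InjOn (fun (S : Finset (Fin n)) (j : Fin (k + 1)) => gapSize S j)
      ((middleSteps n).powersetCard k : Set (Finset (Fin n))) := by
    intro S hS S' hS' h
    exact eq_of_gapSize_eq (mem_powersetCard.1 (mem_coe.1 hS)).2 (mem_powersetCard.1 (mem_coe.1 hS')).2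
      fun j => congrFun h j
  rw [← sum_image (s := (middleSteps n).powersetCard k)
    (g := fun (S : Finset (Fin n)) (j : Fin (k + 1)) => gapSize S j)
    (f := fun g => ∏ j, ((g j).factorial : ℝ)) hinj]
  refine sum_le_sum_of_subset_of_nonneg ?_ fun _ _ _ => prod_nonneg fun _ _ => by positivity
  intro g hg
  obtain ⟨S, hS, rfl⟩ := mem_image.1 hg
  obtain ⟨h1, h2⟩ := mem_powersetCard.1 hS
  exact gapSize_mem_gapTuples h2 hn h1

-- For fixed `π`, the paths `π'` are grouped by the number `k` of shared steps and overcounted by a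
-- union over all `k`-element sets of middle steps. Letting `π'` range over all permutations, not
-- only `T`, loses only a constant factor because `T` has positive density.
open Classical in
theorem sum_sharedSteps_le {n : ℕ} (hn : 2 ≤ n) (T : Finset (Equiv.Perm (Fin n)))
    (p : ℕ → ℝ) (hp : ∀ k, 0 ≤ p k) :
    ∑ π ∈ T, ∑ π' ∈ T with (sharedSteps π π').Nonempty, p #(sharedSteps π π') ≤
      #T * ∑ k ∈ Icc 1 (n - 2), p k * ∑ g ∈ gapTuples k (n - k), ∏ j, ((g j).factorial : ℝ) := by
  rw [← nsmul_eq_mul, ← sum_const]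
  refine sum_le_sum fun π _ => ?_
  calc ∑ π' ∈ T with (sharedSteps π π').Nonempty, p #(sharedSteps π π')
      ≤ ∑ π' with (sharedSteps π π').Nonempty, p #(sharedSteps π π') :=
        sum_le_sum_of_subset_of_nonneg (filter_subset_filter _ (subset_univ T))
          fun _ _ _ => hp _
    _ = ∑ k ∈ Icc 1 (n - 2), ∑ π' with #(sharedSteps π π') = k, p k := by
        have hmaps : ∀ π' ∈ univ.filter (fun π' => (sharedSteps π π').Nonempty),
            #(sharedSteps π π') ∈ Icc 1 (n - 2) := by
          intro π' h
          rw [mem_Icc]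
          refine ⟨card_pos.2 (mem_filter.1 h).2, ?_⟩
          rw [← card_middleSteps]
          exact card_filter_le _ _
        rw [← sum_fiberwise_of_maps_to hmaps]
        refine sum_congr rfl fun k hk => ?_
        have hk := (mem_Icc.1 hk).1
        have : univ.filter (fun π' => #(sharedSteps π π') = k) =
            (univ.filter (fun π' => (sharedSteps π π').Nonempty)).filter
              fun π' => #(sharedSteps π π') = k := by
          ext π'
          simp only [mem_filter, mem_univ, true_and, ← card_pos]
          omega
        rw [this]
        exact sum_congr rfl fun π' h => by rw [(mem_filter.1 h).2]
    _ ≤ _ := by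
        refine sum_le_sum fun k _ => ?_
        rw [sum_const, nsmul_eq_mul, mul_comm]
        refine mul_le_mul_of_nonneg_left (le_trans ?_ (sum_prod_gapSize_le hn)) (hp k)
        have h1 : #(univ.filter fun π' => #(sharedSteps π π') = k) ≤
            ∑ S ∈ (middleSteps n).powersetCard k, #(univ.filter fun π' => S ⊆ sharedSteps π π') := by
          refine le_trans (card_le_card ?_) card_biUnion_le
          intro π' h
          rw [mem_biUnion]
          exact ⟨sharedSteps π π', mem_powersetCard.2 ⟨filter_subset _ _, (mem_filter.1 h).2⟩,
            by simp⟩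
        have h2 : #(univ.filter fun π' => #(sharedSteps π π') = k) ≤
            ∑ S ∈ (middleSteps n).powersetCard k, ∏ j : Fin (k + 1), (gapSize S j).factorial :=
          h1.trans (sum_le_sum fun S hS =>
            card_filter_subset_sharedSteps_le π (mem_powersetCard.1 hS).2)
        exact_mod_cast h2

/-! ### Sums of independent exponentials and the second moment inequality -/

section ExponentialSums

open ENNReal

/-- The law of a sum of `k` independent exponential random variables of mean one. -/
noncomputable def expSumMeasure : ℕ → Measure ℝ
  | 0 => Measure.dirac 0
  | k + 1 => expSumMeasure k ∗ expMeasure 1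

instance : IsProbabilityMeasure (expMeasure 1) := isProbabilityMeasure_expMeasure one_pos

instance (k : ℕ) : IsProbabilityMeasure (expSumMeasure k) := by
  induction k with
  | zero => exact Measure.dirac.isProbabilityMeasure
  | succ k ih => rw [expSumMeasure]; infer_instance

/-- The volume of the simplex of size `t` in dimension `a`. -/
noncomputable def simplexVolume (a : ℕ) (t : ℝ) : ℝ≥0∞ :=
  if 0 ≤ t then ENNReal.ofReal (t ^ a / a.factorial) else 0

@[fun_prop]
theorem measurable_simplexVolume (a : ℕ) : Measurable (simplexVolume a) :=
  Measurable.ite measurableSet_Ici (by fun_prop) measurable_const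

theorem simplexVolume_of_nonneg {a : ℕ} {t : ℝ} (ht : 0 ≤ t) :
    simplexVolume a t = ENNReal.ofReal (t ^ a / a.factorial) := if_pos ht

theorem simplexVolume_of_neg {a : ℕ} {t : ℝ} (ht : t < 0) : simplexVolume a t = 0 :=
  if_neg (not_le.2 ht)

theorem lintegral_expMeasure (f : ℝ → ℝ≥0∞) (hf : Measurable f) :
    ∫⁻ s, f s ∂expMeasure 1 = ∫⁻ s in Set.Ici 0, ENNReal.ofReal (Real.exp (-s)) * f s := by
  have hm : Measurable (gammaPDF 1 1) := (measurable_gammaPDFReal 1 1).ennreal_ofReal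
  rw [expMeasure, gammaMeasure, lintegral_withDensity_eq_lintegral_mul _ hm hf,
    ← lintegral_indicator measurableSet_Ici]
  refine lintegral_congr fun s => ?_
  by_cases hs : 0 ≤ s
  · simp [gammaPDF_of_nonneg, hs]
  · simp [gammaPDF_of_neg (not_le.1 hs), hs]

theorem lintegral_simplexVolume_sub (a : ℕ) (t : ℝ) :
    ∫⁻ s in Set.Ici 0, simplexVolume a (t - s) = simplexVolume (a + 1) t := by
  rcases lt_or_ge t 0 with ht | ht
  · rw [simplexVolume_of_neg ht, setLIntegral_congr_fun (g := fun _ => 0) measurableSet_Ici]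
    · simp
    · intro s hs
      exact simplexVolume_of_neg (by have := Set.mem_Ici.1 hs; linarith)
  · have h1 : ∫⁻ s in Set.Ici 0, simplexVolume a (t - s) =
        ∫⁻ s in Set.Icc 0 t, ENNReal.ofReal ((t - s) ^ a / a.factorial) := by
      rw [← lintegral_indicator measurableSet_Ici, ← lintegral_indicator measurableSet_Icc]
      congr 1
      ext s
      by_cases hs : 0 ≤ s <;> by_cases hst : s ≤ t <;>
        simp [Set.indicator, hs, hst, simplexVolume]
    rw [h1, simplexVolume_of_nonneg ht, ← ofReal_integral_eq_lintegral_ofReal,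
      integral_Icc_eq_integral_Ioc,
      ← intervalIntegral.integral_of_le ht]
    · congr 1
      rw [intervalIntegral.integral_div, intervalIntegral.integral_comp_sub_left (fun s => s ^ a)]
      rw [integral_pow, Nat.factorial_succ]
      push_cast
      field_simp
      simp
    · have h2 : Continuous fun s : ℝ => (t - s) ^ a / a.factorial := by fun_prop
      exact h2.continuousOn.integrableOn_Icc
    · refine (ae_restrict_iff' measurableSet_Icc).2 (ae_of_all _ fun s hs => ?_)
      have := hs.2
      have : 0 ≤ t - s := by linarith
      positivity

/-- The exponential density is at most 1, so it may be replaced by Lebesgue measure on the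
half-line, where convolution only raises the dimension of the simplex. -/
theorem lintegral_simplexVolume_exp_le (a : ℕ) (t : ℝ) :
    ∫⁻ s, simplexVolume a (t - s) ∂expMeasure 1 ≤ simplexVolume (a + 1) t := by
  rw [lintegral_expMeasure _ (by fun_prop),
    ← lintegral_simplexVolume_sub]
  refine setLIntegral_mono' measurableSet_Ici fun s hs => ?_
  refine mul_le_of_le_one_left' ?_
  rw [ENNReal.ofReal_le_one, Real.exp_le_one_iff]
  exact neg_nonpos.2 hs

theorem lintegral_simplexVolume_expSum_le (a k : ℕ) (t : ℝ) :
    ∫⁻ s, simplexVolume a (t - s) ∂expSumMeasure k ≤ simplexVolume (a + k) t := by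
  induction k generalizing a with
  | zero => simp [expSumMeasure]
  | succ k ih =>
    rw [expSumMeasure, Measure.lintegral_conv (by fun_prop)]
    calc _ ≤ ∫⁻ s, simplexVolume (a + 1) (t - s) ∂expSumMeasure k := by
          refine lintegral_mono fun s => ?_
          simp only [← sub_sub]
          exact lintegral_simplexVolume_exp_le a (t - s)
      _ ≤ _ := by
          refine (ih (a + 1)).trans_eq ?_
          congr 1
          ring

theorem expSumMeasure_Iic_eq (k : ℕ) (t : ℝ) :
    expSumMeasure k (Set.Iic t) = ∫⁻ s, simplexVolume 0 (t - s) ∂expSumMeasure k := by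
  rw [← lintegral_indicator_one measurableSet_Iic]
  congr 1
  ext s
  simp [Set.indicator, simplexVolume]

theorem expSumMeasure_Iic_le (k : ℕ) (t : ℝ) :
    expSumMeasure k (Set.Iic t) ≤ simplexVolume k t := by
  rw [expSumMeasure_Iic_eq]
  simpa using lintegral_simplexVolume_expSum_le 0 k t

/-- The weight `exp (-(t - s))` in the integrand combines with the density `exp (-s)` to the
constant `exp (-t)`. Carrying it through the induction avoids losing a factor at each convolution.
-/
theorem le_lintegral_simplexVolume_exp (a : ℕ) (t : ℝ) :
    ENNReal.ofReal (Real.exp (-t)) * simplexVolume (a + 1) t ≤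
      ∫⁻ s, ENNReal.ofReal (Real.exp (-(t - s))) * simplexVolume a (t - s) ∂expMeasure 1 := by
  rw [lintegral_expMeasure _ (by fun_prop),
    ← lintegral_simplexVolume_sub,
    ← lintegral_const_mul _ (by fun_prop)]
  refine setLIntegral_mono' measurableSet_Ici fun s hs => le_of_eq ?_
  rw [← mul_assoc, ← ENNReal.ofReal_mul (Real.exp_pos _).le, ← Real.exp_add]
  ring_nf

theorem le_lintegral_simplexVolume_expSum (a k : ℕ) (t : ℝ) :
    ENNReal.ofReal (Real.exp (-t)) * simplexVolume (a + k) t ≤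
      ∫⁻ s, ENNReal.ofReal (Real.exp (-(t - s))) * simplexVolume a (t - s) ∂expSumMeasure k := by
  induction k generalizing a with
  | zero => simp [expSumMeasure]
  | succ k ih =>
    rw [expSumMeasure, Measure.lintegral_conv (by fun_prop)]
    calc _ = ENNReal.ofReal (Real.exp (-t)) * simplexVolume (a + 1 + k) t := by
          congr 2
          ring
      _ ≤ _ := ih (a + 1)
      _ ≤ _ := by
          refine lintegral_mono fun s => ?_
          simp only [← sub_sub]
          exact le_lintegral_simplexVolume_exp a (t - s)

theorem le_expSumMeasure_Iic (k : ℕ) (t : ℝ) :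
    ENNReal.ofReal (Real.exp (-t)) * simplexVolume k t ≤ expSumMeasure k (Set.Iic t) := by
  rw [expSumMeasure_Iic_eq]
  have h := le_lintegral_simplexVolume_expSum 0 k t
  rw [zero_add] at h
  refine h.trans (lintegral_mono fun s => ?_)
  by_cases hs : 0 ≤ t - s
  · refine mul_le_of_le_one_left' ?_
    rw [ENNReal.ofReal_le_one, Real.exp_le_one_iff]
    exact neg_nonpos.2 hs
  · simp [simplexVolume_of_neg (not_le.1 hs)]

/-- Rewrites the product of two conditional probabilities as a multiple of one simplex volume, which
can then be integrated against the law of the shared weight. -/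
theorem simplexVolume_sq (r : ℕ) (t : ℝ) :
    simplexVolume r t ^ 2 = ((2 * r).choose r : ℝ≥0∞) * simplexVolume (2 * r) t := by
  rcases lt_or_ge t 0 with ht | ht
  · simp [simplexVolume_of_neg ht]
  · rw [simplexVolume_of_nonneg ht, simplexVolume_of_nonneg ht, ← ENNReal.ofReal_pow (by positivity),
      ← ENNReal.ofReal_natCast, ← ENNReal.ofReal_mul (by positivity)]
    congr 1
    have h : ((2 * r).choose r : ℝ) * (r.factorial * r.factorial) = (2 * r).factorial := by
      have := Nat.choose_mul_factorial_mul_factorial (show r ≤ 2 * r by omega)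
      rw [show 2 * r - r = r by omega, mul_assoc] at this
      exact_mod_cast this
    rw [← h]
    have h0 : ((2 * r).choose r : ℝ) ≠ 0 := by
      have := Nat.choose_pos (show r ≤ 2 * r by omega)
      positivity
    field_simp
    ring

section Sums

variable {E Ω : Type*} [MeasurableSpace Ω] {μ : Measure Ω} {X : E → Ω → ℝ}

theorem indepFun_sum (hX : ∀ e, Measurable (X e)) (hind : iIndepFun X μ) {A B : Finset E}
    (h : Disjoint A B) : IndepFun (∑ e ∈ A, X e) (∑ e ∈ B, X e) μ := by
  have := (hind.indepFun_finset A B h hX).comp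
    (φ := fun x : A → ℝ => ∑ i, x i) (ψ := fun x : B → ℝ => ∑ i, x i) (by fun_prop) (by fun_prop)
  convert this using 1 <;>
  · ext ω
    simp only [Function.comp, Finset.sum_apply]
    rw [← Finset.sum_coe_sort]

variable [IsProbabilityMeasure μ]

theorem hasLaw_sum_expSumMeasure (hX : ∀ e, Measurable (X e))
    (hlaw : ∀ e, HasLaw (X e) (expMeasure 1) μ) (hind : iIndepFun X μ) (A : Finset E) :
    μ.map (∑ e ∈ A, X e) = expSumMeasure #A := by
  classical
  induction A using Finset.induction_on with
  | empty => simp [expSumMeasure, Pi.zero_def]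
  | insert e A he ih =>
    rw [sum_insert he, card_insert_of_notMem he, expSumMeasure, ← ih, ← (hlaw e).map_eq, add_comm]
    exact (hind.indepFun_finsetSum_of_notMem hX he).map_add_eq_map_conv_map
      (by fun_prop) (hX e)

/-- The weights split as `Z + Y` and `Z + Y'` with `Z` the shared part and `Z, Y, Y'` independent.
Given `Z = z`, the event has probability the square of that of `Y ≤ x - z`. -/
theorem measure_sum_le_inter_le (hX : ∀ e, Measurable (X e))
    (hlaw : ∀ e, HasLaw (X e) (expMeasure 1) μ) (hind : iIndepFun X μ) [DecidableEq E]
    {A B : Finset E} {k r : ℕ} (hk : #(A ∩ B) = k) (hA : #A = k + r) (hB : #B = k + r) {x : ℝ} :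
    μ ({ω | ∑ e ∈ A, X e ω ≤ x} ∩ {ω | ∑ e ∈ B, X e ω ≤ x}) ≤
      ((2 * r).choose r : ℝ≥0∞) * simplexVolume (2 * r + k) x := by
  set Z := ∑ e ∈ A ∩ B, X e with hZ
  set Y := ∑ e ∈ A \ B, X e with hY
  set Y' := ∑ e ∈ B \ A, X e with hY'
  have mZ : Measurable Z := by fun_prop
  have mY : Measurable Y := by fun_prop
  have mY' : Measurable Y' := by fun_prop
  have cA : #(A \ B) = r := by
    have := card_sdiff_add_card_inter A B
    omega
  have cB : #(B \ A) = r := by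
    have := card_sdiff_add_card_inter B A
    rw [inter_comm] at this
    omega
  have lZ : μ.map Z = expSumMeasure k := hk ▸ hasLaw_sum_expSumMeasure hX hlaw hind _
  have lY : μ.map Y = expSumMeasure r := by
    have := hasLaw_sum_expSumMeasure hX hlaw hind (A \ B)
    rwa [cA] at this
  have lY' : μ.map Y' = expSumMeasure r := by
    have := hasLaw_sum_expSumMeasure hX hlaw hind (B \ A)
    rwa [cB] at this
  have iYY' : IndepFun Y Y' μ := indepFun_sum hX hind disjoint_sdiff_sdiff
  have iZ : IndepFun Z (fun ω => (Y ω, Y' ω)) μ := by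
    have hd : Disjoint (A ∩ B) ((A \ B) ∪ (B \ A)) := by
      rw [Finset.disjoint_left]
      intro e
      simp only [mem_inter, mem_union, Finset.mem_sdiff]
      tauto
    have := (hind.indepFun_finset _ _ hd hX).comp
      (φ := fun x : (A ∩ B : Finset E) → ℝ => ∑ i, x i)
      (ψ := fun x : ((A \ B) ∪ (B \ A) : Finset E) → ℝ =>
        (∑ i : (A \ B : Finset E), x ⟨i, mem_union_left _ i.2⟩,
          ∑ i : (B \ A : Finset E), x ⟨i, mem_union_right _ i.2⟩)) (by fun_prop) (by fun_prop)
    convert this using 1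
    · ext ω
      simp only [Function.comp, hZ, Finset.sum_apply]
      rw [← Finset.sum_coe_sort]
    · ext ω
      · simp only [Function.comp, hY, Finset.sum_apply]
        rw [← Finset.sum_coe_sort]
      · simp only [Function.comp, hY', Finset.sum_apply]
        rw [← Finset.sum_coe_sort]
  have joint : μ.map (fun ω => (Z ω, Y ω, Y' ω)) =
      (expSumMeasure k).prod ((expSumMeasure r).prod (expSumMeasure r)) := by
    rw [(indepFun_iff_map_prod_eq_prod_map_map mZ.aemeasurable (by fun_prop)).1 iZ,
      (indepFun_iff_map_prod_eq_prod_map_map mY.aemeasurable mY'.aemeasurable).1 iYY', lZ, lY, lY']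
  have hset : MeasurableSet {p : ℝ × ℝ × ℝ | p.1 + p.2.1 ≤ x ∧ p.1 + p.2.2 ≤ x} := by
    measurability
  have hev : {ω | ∑ e ∈ A, X e ω ≤ x} ∩ {ω | ∑ e ∈ B, X e ω ≤ x} =
      (fun ω => (Z ω, Y ω, Y' ω)) ⁻¹' {p | p.1 + p.2.1 ≤ x ∧ p.1 + p.2.2 ≤ x} := by
    ext ω
    have h1 : ∑ e ∈ A, X e ω = Z ω + Y ω := by
      rw [hZ, hY, Finset.sum_apply, Finset.sum_apply, Finset.sum_inter_add_sum_sdiff]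
    have h2 : ∑ e ∈ B, X e ω = Z ω + Y' ω := by
      rw [hZ, hY', Finset.sum_apply, Finset.sum_apply, inter_comm, Finset.sum_inter_add_sum_sdiff]
    simp [h1, h2]
  rw [hev, ← Measure.map_apply (by fun_prop) hset, joint, Measure.prod_apply hset]
  calc _ = ∫⁻ z, expSumMeasure r (Set.Iic (x - z)) ^ 2 ∂expSumMeasure k := by
        refine lintegral_congr fun z => ?_
        rw [sq, ← Measure.prod_prod]
        congr 1
        ext p
        simp [le_sub_iff_add_le', Prod.le_def]
    _ ≤ ∫⁻ z, ((2 * r).choose r : ℝ≥0∞) * simplexVolume (2 * r) (x - z) ∂expSumMeasure k := by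
        refine lintegral_mono fun z => ?_
        rw [← simplexVolume_sq]
        gcongr
        exact expSumMeasure_Iic_le r _
    _ ≤ _ := by
        rw [lintegral_const_mul _ (by fun_prop)]
        gcongr
        exact lintegral_simplexVolume_expSum_le _ _ _

end Sums

/-- The second moment method for the number of events that occur. -/
theorem measureReal_biInter_compl_mul_sq_le {ι Ω : Type*} [MeasurableSpace Ω] {μ : Measure Ω}
    [IsProbabilityMeasure μ] (T : Finset ι) {A : ι → Set Ω} (hA : ∀ i, MeasurableSet (A i)) :
    μ.real (⋂ i ∈ T, (A i)ᶜ) * (∑ i ∈ T, μ.real (A i)) ^ 2 ≤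
      ∑ i ∈ T, ∑ j ∈ T, (μ.real (A i ∩ A j) - μ.real (A i) * μ.real (A j)) := by
  set N : Ω → ℝ := fun ω => ∑ i ∈ T, (A i).indicator 1 ω with hN
  set m := ∑ i ∈ T, μ.real (A i) with hm
  have hint : ∀ i, Integrable ((A i).indicator (1 : Ω → ℝ)) μ := fun i =>
    (integrable_const (1 : ℝ)).indicator (hA i)
  have hint2 : ∀ i j, Integrable ((A i ∩ A j).indicator (1 : Ω → ℝ)) μ := fun i j =>
    (integrable_const (1 : ℝ)).indicator ((hA i).inter (hA j))
  have hsq : ∀ ω, (N ω - m) ^ 2 =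
      ∑ i ∈ T, ∑ j ∈ T, (A i ∩ A j).indicator (1 : Ω → ℝ) ω - 2 * m * N ω + m ^ 2 := by
    intro ω
    have : N ω ^ 2 = ∑ i ∈ T, ∑ j ∈ T, (A i ∩ A j).indicator (1 : Ω → ℝ) ω := by
      rw [sq, hN, Finset.sum_mul_sum]
      simp only [Set.inter_indicator_one, Pi.mul_apply]
    rw [← this]
    ring
  have hNint : Integrable N μ := integrable_finsetSum _ fun i _ => hint i
  have hN2int : Integrable
      (fun ω => ∑ i ∈ T, ∑ j ∈ T, (A i ∩ A j).indicator (1 : Ω → ℝ) ω) μ :=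
    integrable_finsetSum _ fun i _ => integrable_finsetSum _ fun j _ => hint2 i j
  have hEN : ∫ ω, N ω ∂μ = m := by
    rw [hN, integral_finsetSum _ fun i _ => hint i]
    exact sum_congr rfl fun i _ => integral_indicator_one (hA i)
  have hEN2 : ∫ ω, ∑ i ∈ T, ∑ j ∈ T, (A i ∩ A j).indicator (1 : Ω → ℝ) ω ∂μ =
      ∑ i ∈ T, ∑ j ∈ T, μ.real (A i ∩ A j) := by
    rw [integral_finsetSum _ fun i _ => integrable_finsetSum _ fun j _ => hint2 i j]
    refine sum_congr rfl fun i _ => ?_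
    rw [integral_finsetSum _ fun j _ => hint2 i j]
    exact sum_congr rfl fun j _ => integral_indicator_one ((hA i).inter (hA j))
  have hI2 : Integrable (fun ω => 2 * m * N ω) μ := hNint.const_mul _
  have hI1 : Integrable (fun ω => ∑ i ∈ T, ∑ j ∈ T, (A i ∩ A j).indicator (1 : Ω → ℝ) ω -
      2 * m * N ω) μ := hN2int.sub hI2
  have hvar : ∫ ω, (N ω - m) ^ 2 ∂μ =
      ∑ i ∈ T, ∑ j ∈ T, (μ.real (A i ∩ A j) - μ.real (A i) * μ.real (A j)) := by
    simp only [hsq]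
    rw [integral_add hI1 (integrable_const _), integral_sub hN2int hI2, integral_const_mul,
      hEN, hEN2]
    simp only [sum_sub_distrib, ← Finset.sum_mul_sum, ← hm]
    simp
    ring
  have hB : MeasurableSet (⋂ i ∈ T, (A i)ᶜ) :=
    Finset.measurableSet_biInter _ fun i _ => (hA i).compl
  have hint3 : Integrable (fun ω => (N ω - m) ^ 2) μ := by
    simp only [hsq]
    exact hI1.add (integrable_const _)
  -- Chebyshev: if none of the events occurs then `N = 0` and `(N - m) ^ 2 = m ^ 2`.
  rw [← hvar, ← smul_eq_mul, ← integral_indicator_const _ hB]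
  refine integral_mono ((integrable_const _).indicator hB) hint3 fun ω => ?_
  by_cases h : ω ∈ ⋂ i ∈ T, (A i)ᶜ
  · have h0 : N ω = 0 := by
      refine sum_eq_zero fun i hi => ?_
      rw [Set.mem_iInter₂] at h
      exact Set.indicator_of_notMem (h i hi) _
    simp only [Set.indicator_of_mem h, h0]
    apply le_of_eq
    ring
  · simp only [Set.indicator_of_notMem h]
    positivity

end ExponentialSums

/-! ### Density of the admissible paths -/

/-- Left multiplication by a permutation carrying `(i, j)` to `(a, b)` is a bijection between the
two sets. -/
theorem card_filter_apply_apply_eq {n : ℕ} {i j a b : Fin n} (hij : i ≠ j) (hab : a ≠ b) :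
    #(univ.filter fun π : Equiv.Perm (Fin n) => (π i, π j) = (a, b)) =
      #(univ.filter fun π : Equiv.Perm (Fin n) => (π i, π j) = (i, j)) := by
  set ρ : Equiv.Perm (Fin n) := Equiv.swap (Equiv.swap i a j) b * Equiv.swap i a with hρ
  have h1 : ρ i = a := by
    have h : a ≠ Equiv.swap i a j := fun h => hij <| by
      rw [← (Equiv.swap i a).injective.eq_iff, ← h, Equiv.swap_apply_left]
    rw [hρ, Equiv.Perm.mul_apply, Equiv.swap_apply_left, Equiv.swap_apply_of_ne_of_ne h hab]
  have h2 : ρ j = b := by rw [hρ, Equiv.Perm.mul_apply, Equiv.swap_apply_left]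
  refine (card_equiv (Equiv.mulLeft ρ) fun π => ?_).symm
  simp only [mem_filter, mem_univ, true_and, Equiv.coe_mulLeft, Equiv.Perm.mul_apply,
    Prod.mk.injEq]
  constructor
  · rintro ⟨h, h'⟩
    rw [h, h']
    exact ⟨h1, h2⟩
  · rintro ⟨h, h'⟩
    exact ⟨ρ.injective (h.trans h1.symm), ρ.injective (h'.trans h2.symm)⟩

/-- The pair of first and last directions is equidistributed over the ordered pairs of distinct
directions. As `2 * u ≤ n`, the two blocks of size `u` are disjoint, so all `u ^ 2` pairs from them
are available. -/
theorem sq_mul_factorial_le_card {n u : ℕ} (hn : 2 ≤ n) (hu : 2 * u ≤ n)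
    (T : Finset (Equiv.Perm (Fin n)))
    (hT : ∀ π : Equiv.Perm (Fin n), (π ⟨0, by omega⟩ : ℕ) < u →
      n - u ≤ (π ⟨n - 1, by omega⟩ : ℕ) → π ∈ T) :
    u ^ 2 * n.factorial ≤ n ^ 2 * #T := by
  set i : Fin n := ⟨0, by omega⟩ with hi
  set j : Fin n := ⟨n - 1, by omega⟩ with hj
  have hij : i ≠ j := by
    rw [Ne, Fin.ext_iff]
    simp only [hi, hj]
    omega
  set c := #(univ.filter fun π : Equiv.Perm (Fin n) => (π i, π j) = (i, j)) with hc
  have h1 : n.factorial ≤ c * n ^ 2 := by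
    have h := card_le_mul_card_image_of_maps_to (s := (univ : Finset (Equiv.Perm (Fin n))))
      (f := fun π => (π i, π j)) (t := (univ : Finset (Fin n)).offDiag)
      (fun π _ => by simp [hij]) c fun p hp => by
        obtain ⟨-, -, hp⟩ := mem_offDiag.1 hp
        exact (card_filter_apply_apply_eq hij hp).le
    rw [card_univ, Fintype.card_perm, Fintype.card_fin, offDiag_card, card_univ,
      Fintype.card_fin] at h
    refine h.trans ?_
    rw [sq]
    gcongr
    omega
  have h2 : c * u ^ 2 ≤ #T := by
    set a := univ.filter fun l : Fin n => (l : ℕ) < u with ha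
    set b := univ.filter fun l : Fin n => n - u ≤ (l : ℕ) with hb
    have ca : #a = u := by rw [ha, Fin.card_filter_val_lt, min_eq_right (by omega)]
    have cb : #b = u := by
      have h := card_filter_add_card_filter_not (s := (univ : Finset (Fin n)))
        (fun l : Fin n => (l : ℕ) < n - u)
      simp only [not_lt] at h
      rw [Fin.card_filter_val_lt, min_eq_right (by omega), ← hb, card_univ,
        Fintype.card_fin] at h
      omega
    have h := mul_card_image_le_card_of_maps_to
      (s := T.filter fun π => (π i, π j) ∈ a ×ˢ b)
      (f := fun π => (π i, π j)) (t := a ×ˢ b) (fun π hπ => (mem_filter.1 hπ).2) c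
      fun p hp => by
        obtain ⟨hp1, hp2⟩ := mem_product.1 hp
        rw [ha, mem_filter] at hp1
        rw [hb, mem_filter] at hp2
        have hne : p.1 ≠ p.2 := by
          rw [Ne, Fin.ext_iff]
          omega
        rw [hc, ← card_filter_apply_apply_eq hij hne]
        refine card_le_card fun π hπ => ?_
        have hπ := (mem_filter.1 hπ).2
        rw [mem_filter, mem_filter, hπ]
        refine ⟨⟨hT π ?_ ?_, hp⟩, rfl⟩
        · rw [show π i = p.1 from congrArg Prod.fst hπ]
          exact hp1.2
        · rw [show π j = p.2 from congrArg Prod.snd hπ]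
          exact hp2.2
    rw [card_product, ca, cb, ← sq] at h
    exact h.trans (card_filter_le _ _)
  calc u ^ 2 * n.factorial ≤ u ^ 2 * (c * n ^ 2) := by gcongr
    _ = n ^ 2 * (c * u ^ 2) := by ring
    _ ≤ _ := by gcongr

open Classical in
theorem exists_mul_factorial_le_card_connectingPaths {C : ℝ} (hC : 0 < C) :
    ∃ c : ℝ, 0 < c ∧ ∀ᶠ n : ℕ in atTop,
      c * n.factorial ≤ #(univ.filter fun π => π ∈ connectingPaths C n) := by
  -- Capping at `1/2` keeps the two blocks of directions disjoint. Once `n ≥ 2 / C'`, rounding down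
  -- costs at most half, whence the constant `(C' / 2) ^ 2`.
  set C' := min C (1 / 2) with hC'
  have h0 : 0 < C' := lt_min hC (by norm_num)
  have h1 : C' ≤ C := min_le_left _ _
  have h2 : C' ≤ 1 / 2 := min_le_right _ _
  refine ⟨(C' / 2) ^ 2, by positivity, ?_⟩
  filter_upwards [eventually_ge_atTop 2, eventually_ge_atTop ⌈2 / C'⌉₊] with n hn hn'
  have hn0 : (0 : ℝ) < n := by
    have : 0 < n := by omega
    exact_mod_cast this
  set u := ⌊C' * n⌋₊ with hu
  have hu1 : (u : ℝ) ≤ C' * n := Nat.floor_le (by positivity)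
  have hu2 : C' / 2 * n ≤ u := by
    have h3 := Nat.lt_floor_add_one (C' * n)
    have h4 : 2 / C' ≤ n := (Nat.le_ceil _).trans (by exact_mod_cast hn')
    rw [div_le_iff₀ h0] at h4
    rw [← hu] at h3
    linarith
  have hun : 2 * u ≤ n := by
    have : (2 * u : ℝ) ≤ n := by nlinarith
    exact_mod_cast this
  have h := sq_mul_factorial_le_card hn hun (univ.filter fun π => π ∈ connectingPaths C n) <| by
    intro π hπ1 hπ2
    rw [mem_filter]
    have hCn : C' * n ≤ C * n := by gcongr
    refine ⟨mem_univ _, fun i hi => ?_, fun i hi => ?_⟩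
    · rw [show i = ⟨0, by omega⟩ from Fin.ext hi]
      change ((π _ : ℕ) : ℝ) + 1 ≤ C * n
      have : ((π ⟨0, by omega⟩ : ℕ) : ℝ) + 1 ≤ u := by exact_mod_cast hπ1
      linarith
    · rw [show i = ⟨n - 1, by omega⟩ from Fin.ext (by simp only; omega)]
      change (1 - C) * n ≤ ((π _ : ℕ) : ℝ) + 1
      have : (n : ℝ) ≤ ((π ⟨n - 1, by omega⟩ : ℕ) : ℝ) + u := by
        exact_mod_cast (show n ≤ (π ⟨n - 1, by omega⟩ : ℕ) + u by omega)
      linarith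
  have h' : (u : ℝ) ^ 2 * n.factorial ≤
      n ^ 2 * #(univ.filter fun π => π ∈ connectingPaths C n) := by exact_mod_cast h
  refine le_of_mul_le_mul_left (le_trans ?_ h') (show (0 : ℝ) < n ^ 2 by positivity)
  calc (n : ℝ) ^ 2 * ((C' / 2) ^ 2 * n.factorial) = (C' / 2 * n) ^ 2 * n.factorial := by ring
    _ ≤ _ := by gcongr

/-! ### Variance relative to the squared mean -/

theorem le_expSumMeasure_real_Iic (k : ℕ) {x : ℝ} (hx : 0 ≤ x) :
    Real.exp (-x) * (x ^ k / k.factorial) ≤ (expSumMeasure k).real (Set.Iic x) := by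
  have h := le_expSumMeasure_Iic k x
  rw [simplexVolume_of_nonneg hx, ← ENNReal.ofReal_mul (Real.exp_pos _).le] at h
  exact (ENNReal.ofReal_le_iff_le_toReal (measure_ne_top _ _)).1 h

/-- The bound on the probability that two paths which share `k` of their `m` edges both have
weight at most `x`. -/
noncomputable def pairBound (x : ℝ) (m k : ℕ) : ℝ :=
  ((2 * (m - k)).choose (m - k) : ℝ) * (x ^ (2 * m - k) / (2 * m - k).factorial)

theorem pairBound_nonneg {x : ℝ} (hx : 0 ≤ x) (m k : ℕ) : 0 ≤ pairBound x m k := by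
  unfold pairBound
  positivity

/-- Here `n = r + k + 2`, and `(r + 2)!` is the factorial of the number of steps outside the shared
set. The lower bound on the single-path probability enters squared, producing `exp (2 * x)` and
cancelling all powers of `x` but `x ^ k`. -/
theorem pairBound_mul_factorial_le {x D : ℝ} (hx : 0 < x) {k r : ℕ}
    (hD : ((2 * r).factorial * (r + k).factorial : ℝ) ≤ D * (r.factorial * (2 * r + k).factorial)) :
    pairBound x (r + k) k * (r + 2).factorial ≤
      Real.exp (2 * x) * (r + k + 2).factorial *
        (expSumMeasure (r + k)).real (Set.Iic x) ^ 2 * (D / x ^ k) := by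
  have hD0 : 0 ≤ D := by
    by_contra! h
    have h1 : D * (r.factorial * (2 * r + k).factorial : ℝ) ≤ 0 :=
      mul_nonpos_of_nonpos_of_nonneg h.le (by positivity)
    have h2 : (0 : ℝ) < (2 * r).factorial * (r + k).factorial := by positivity
    linarith
  have hp := le_expSumMeasure_real_Iic (r + k) hx.le
  set p := (expSumMeasure (r + k)).real (Set.Iic x)
  have hN : (((r + 2).factorial * (r + k).factorial : ℕ) : ℝ) ≤
      ((r + k + 2).factorial * r.factorial : ℕ) := by
    refine Nat.cast_le.2 ?_
    rw [Nat.factorial_succ (r + k + 1), Nat.factorial_succ (r + k), Nat.factorial_succ (r + 1),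
      Nat.factorial_succ r]
    calc (r + 1 + 1) * ((r + 1) * r.factorial) * (r + k).factorial
        = (r + 1 + 1) * ((r + 1) * ((r + k).factorial * r.factorial)) := by ring
      _ ≤ (r + k + 1 + 1) * ((r + k + 1) * ((r + k).factorial * r.factorial)) := by
        gcongr <;> omega
      _ = _ := by ring
  push_cast at hN
  have hch : ((2 * r).choose r : ℝ) = (2 * r).factorial / (r.factorial * r.factorial) := by
    rw [eq_div_iff (by positivity)]
    have := Nat.choose_mul_factorial_mul_factorial (show r ≤ 2 * r by omega)
    rw [show 2 * r - r = r by omega, mul_assoc] at this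
    exact_mod_cast this
  have e1 : r + k - k = r := by omega
  have e2 : 2 * (r + k) - k = 2 * r + k := by omega
  rw [pairBound, e1, e2, hch]
  calc ((2 * r).factorial / (r.factorial * r.factorial) *
          (x ^ (2 * r + k) / (2 * r + k).factorial) * (r + 2).factorial : ℝ)
      = x ^ (2 * r + k) * (((2 * r).factorial * (r + k).factorial) *
          ((r + 2).factorial * (r + k).factorial)) /
          (r.factorial * r.factorial * (2 * r + k).factorial *
            ((r + k).factorial * (r + k).factorial)) := by field_simp
    _ ≤ x ^ (2 * r + k) * ((D * (r.factorial * (2 * r + k).factorial)) *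
          ((r + k + 2).factorial * r.factorial)) /
          (r.factorial * r.factorial * (2 * r + k).factorial *
            ((r + k).factorial * (r + k).factorial)) := by gcongr
    _ = Real.exp (2 * x) * (r + k + 2).factorial *
          (Real.exp (-x) * (x ^ (r + k) / (r + k).factorial)) ^ 2 * (D / x ^ k) := by
        have h1 : Real.exp (2 * x) * Real.exp (-x) ^ 2 = 1 := by
          rw [← Real.exp_nat_mul, ← Real.exp_add]
          simp
        calc _ = (Real.exp (2 * x) * Real.exp (-x) ^ 2) *
              ((r + k + 2).factorial * (x ^ (r + k) / (r + k).factorial) ^ 2 * (D / x ^ k)) := by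
              rw [h1]
              field_simp
              ring
          _ = _ := by ring
    _ ≤ _ := by gcongr

-- Turns termwise bounds for each overlap `k` into a bound for the probability that no path of `T`
-- is light: `D` controls the joint probability and `V` the number of overlapping partners.
open Classical in
theorem measureReal_biInter_le {n : ℕ} (hn : 2 ≤ n) {Ω : Type*} [MeasurableSpace Ω]
    {μ : Measure Ω} [IsProbabilityMeasure μ] {X : (hypercube n).edgeSet → Ω → ℝ}
    (hX : ∀ e, Measurable (X e)) (hlaw : ∀ e, HasLaw (X e) (expMeasure 1) μ)
    (hind : iIndepFun X μ) {x c : ℝ} (hx : 0 < x) (hc : 0 < c)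
    (T : Finset (Equiv.Perm (Fin n))) (hT : c * n.factorial ≤ #T) (b : ℕ → ℝ)
    (hb : ∀ k r, k + r + 2 = n → 1 ≤ k → ∃ D V : ℝ,
      ((2 * r).factorial * (r + k).factorial : ℝ) ≤ D * (r.factorial * (2 * r + k).factorial) ∧
      ∑ g ∈ gapTuples k (r + 2), ∏ j, ((g j).factorial : ℝ) ≤ (r + 2).factorial * V ∧
      D * V / x ^ k ≤ b k) :
    μ.real (⋂ π ∈ T, {ω | middleWeight (fun e => X e ω) π ≤ x}ᶜ) ≤
      c⁻¹ * Real.exp (2 * x) * ∑ k ∈ Icc 1 (n - 2), b k := by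
  set m := n - 2 with hm
  set A : Equiv.Perm (Fin n) → Set Ω := fun π => {ω | ∑ e ∈ middleEdges π, X e ω ≤ x} with hA
  have hAm : ∀ π, MeasurableSet (A π) := fun π => measurableSet_le (by fun_prop) (by fun_prop)
  set p := (expSumMeasure m).real (Set.Iic x) with hp
  have hp0 : 0 < p := lt_of_lt_of_le (by positivity) (le_expSumMeasure_real_Iic m hx.le)
  have hAp : ∀ π, μ.real (A π) = p := by
    intro π
    have h := hasLaw_sum_expSumMeasure hX hlaw hind (middleEdges π)
    rw [card_middleEdges] at h
    rw [hp, ← h, measureReal_def, measureReal_def,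
      Measure.map_apply (by fun_prop) measurableSet_Iic]
    congr 2
    ext ω
    simp [hA]
  have hT0 : (0 : ℝ) < #T := lt_of_lt_of_le (by positivity) hT
  have key := measureReal_biInter_compl_mul_sq_le (μ := μ) T hAm
  have hpair : ∀ π π', μ.real (A π ∩ A π') - μ.real (A π) * μ.real (A π') ≤
      if (sharedSteps π π').Nonempty then pairBound x m #(sharedSteps π π') else 0 := by
    intro π π'
    split_ifs with h
    · have hk : #(sharedSteps π π') ≤ m := by
        rw [hm, ← card_middleSteps]
        exact card_filter_le _ _
      have h1 := measure_sum_le_inter_le hX hlaw hind (A := middleEdges π) (B := middleEdges π')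
        (r := m - #(sharedSteps π π')) (x := x) (card_middleEdges_inter π π')
        (by rw [card_middleEdges]; omega) (by rw [card_middleEdges]; omega)
      rw [simplexVolume_of_nonneg hx.le, ← ENNReal.ofReal_natCast,
        ← ENNReal.ofReal_mul (by positivity),
        show 2 * (m - #(sharedSteps π π')) + #(sharedSteps π π') =
          2 * m - #(sharedSteps π π') by omega] at h1
      have h2 : μ.real (A π ∩ A π') ≤ pairBound x m #(sharedSteps π π') :=
        ENNReal.toReal_le_of_le_ofReal (pairBound_nonneg hx.le _ _) h1
      have h3 : 0 ≤ μ.real (A π) * μ.real (A π') := by positivity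
      linarith
    -- No shared middle edge: the two weights are independent and the covariance is zero.
    · have hd : Disjoint (middleEdges π) (middleEdges π') := by
        rw [disjoint_iff_inter_eq_empty, ← card_eq_zero, card_middleEdges_inter, card_eq_zero]
        exact not_nonempty_iff_eq_empty.1 h
      have hi := (indepFun_sum hX hind hd).measure_inter_preimage_eq_mul _ _
        (measurableSet_Iic (a := x)) (measurableSet_Iic (a := x))
      have e : ∀ π, (∑ e ∈ middleEdges π, X e) ⁻¹' Set.Iic x = A π := by
        intro π
        ext ω
        simp [hA]
      rw [e, e] at hi
      rw [measureReal_def, hi, ENNReal.toReal_mul]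
      simp [measureReal_def]
  have hsum : ∑ π ∈ T, ∑ π' ∈ T, (μ.real (A π ∩ A π') - μ.real (A π) * μ.real (A π')) ≤
      #T * ∑ k ∈ Icc 1 m, pairBound x m k *
        ∑ g ∈ gapTuples k (n - k), ∏ j, ((g j).factorial : ℝ) := by
    refine le_trans ?_ (sum_sharedSteps_le hn T (pairBound x m) (pairBound_nonneg hx.le m))
    refine sum_le_sum fun π _ => ?_
    rw [sum_filter]
    exact sum_le_sum fun π' _ => hpair π π'
  have hterm : ∑ k ∈ Icc 1 m, pairBound x m k *
        ∑ g ∈ gapTuples k (n - k), ∏ j, ((g j).factorial : ℝ) ≤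
      Real.exp (2 * x) * n.factorial * p ^ 2 * ∑ k ∈ Icc 1 m, b k := by
    rw [mul_sum]
    refine sum_le_sum fun k hk => ?_
    obtain ⟨hk1, hk2⟩ := mem_Icc.1 hk
    obtain ⟨r, hr⟩ := Nat.exists_eq_add_of_le' hk2
    obtain ⟨D, V, hD, hV, hDV⟩ := hb k r (by omega) hk1
    have e : n - k = r + 2 := by omega
    have e' : n = r + k + 2 := by omega
    have hV0 : 0 ≤ V := by
      have h1 : (0 : ℝ) ≤ (r + 2).factorial * V :=
        le_trans (sum_nonneg fun _ _ => prod_nonneg fun _ _ => by positivity) hV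
      exact nonneg_of_mul_nonneg_right h1 (by positivity)
    have hpb := pairBound_mul_factorial_le hx hD
    rw [← hr, ← hp] at hpb
    rw [e, e', ← hr]
    calc pairBound x m k * ∑ g ∈ gapTuples k (r + 2), ∏ j, ((g j).factorial : ℝ)
        ≤ pairBound x m k * ((r + 2).factorial * V) :=
          mul_le_mul_of_nonneg_left hV (pairBound_nonneg hx.le _ _)
      _ = pairBound x m k * (r + 2).factorial * V := by ring
      _ ≤ (Real.exp (2 * x) * (m + 2).factorial * p ^ 2 * (D / x ^ k)) * V := by gcongr
      _ = Real.exp (2 * x) * (m + 2).factorial * p ^ 2 * (D * V / x ^ k) := by ring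
      _ ≤ _ := by gcongr
  have hb0 : 0 ≤ ∑ k ∈ Icc 1 m, b k := by
    have h1 : 0 ≤ Real.exp (2 * x) * n.factorial * p ^ 2 * ∑ k ∈ Icc 1 m, b k :=
      le_trans (sum_nonneg fun k _ => mul_nonneg (pairBound_nonneg hx.le _ _)
        (sum_nonneg fun _ _ => prod_nonneg fun _ _ => by positivity)) hterm
    exact nonneg_of_mul_nonneg_right h1 (by positivity)
  have hset : (⋂ π ∈ T, {ω | middleWeight (fun e => X e ω) π ≤ x}ᶜ) = ⋂ π ∈ T, (A π)ᶜ := by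
    simp only [middleWeight_eq, hA]
  rw [hset]
  simp only [hAp, sum_const, nsmul_eq_mul] at key
  have hfin : μ.real (⋂ π ∈ T, (A π)ᶜ) * (#T * p) ^ 2 ≤
      (c⁻¹ * Real.exp (2 * x) * ∑ k ∈ Icc 1 m, b k) * (#T * p) ^ 2 := by
    simp only [hAp] at hsum
    calc _ ≤ (#T : ℝ) * (Real.exp (2 * x) * n.factorial * p ^ 2 * ∑ k ∈ Icc 1 m, b k) :=
          (key.trans hsum).trans (by gcongr)
      -- The density of `T` trades `n!` for a second factor `#T`, completing the squared mean.
      _ = #T * Real.exp (2 * x) * p ^ 2 * (∑ k ∈ Icc 1 m, b k) * c⁻¹ * (c * n.factorial) := by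
          field_simp
      _ ≤ #T * Real.exp (2 * x) * p ^ 2 * (∑ k ∈ Icc 1 m, b k) * c⁻¹ * #T := by gcongr
      _ = _ := by ring
  exact le_of_mul_le_mul_right hfin (by positivity)

theorem exists_inv_add_lt {x : ℝ} (hx : 1 < x) :
    ∃ (q : ℕ) (δ : ℝ), 3 < q ∧ 0 < δ ∧ δ ≤ 1 ∧ (1 - 3 / q : ℝ)⁻¹ + δ < x := by
  have h : Tendsto (fun q : ℕ => (1 - 3 / q : ℝ)⁻¹) atTop (𝓝 1) := by
    have h1 : Tendsto (fun q : ℕ => (1 - 3 / q : ℝ)) atTop (𝓝 (1 - 0)) :=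
      tendsto_const_nhds.sub (tendsto_const_div_atTop_nhds_zero_nat 3)
    have h2 := h1.inv₀ (by norm_num)
    simpa using h2
  have h3 : (1 : ℝ) < 1 + (x - 1) / 2 := by linarith
  obtain ⟨q, hq, hq3⟩ := ((h.eventually_lt_const h3).and (eventually_gt_atTop 3)).exists
  refine ⟨q, min 1 ((x - 1) / 2), hq3, lt_min one_pos (by linarith), min_le_left _ _, ?_⟩
  have := min_le_right 1 ((x - 1) / 2)
  linarith

/-- The sum over all `1 ≤ k ≤ n - 2` of this quantity bounds the variance of the number of light
paths, relative to the square of its mean. -/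
noncomputable def overlapBound (q : ℕ) (δ β ρ : ℝ) (n k : ℕ) : ℝ :=
  8 / n * ((k + 1) * (8 / 9) ^ k) + (n + 1) ^ (n.sqrt + 1) * (1 / 2) ^ (n / 16) +
    ((n + 1) / δ) ^ q * β * ρ ^ n.sqrt

theorem exists_overlap_bounds {x δ β : ℝ} {q n k r : ℕ} (hx : 1 < x) (hq : 3 < q) (hδ0 : 0 < δ)
    (hδ1 : δ ≤ 1) (hβ : β = (1 - 3 / q : ℝ)⁻¹ + δ) (hβx : β < x) (hn : 16 ≤ n)
    (hkr : k + r + 2 = n) (hk : 1 ≤ k) :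
    ∃ D V : ℝ,
      ((2 * r).factorial * (r + k).factorial : ℝ) ≤ D * (r.factorial * (2 * r + k).factorial) ∧
      ∑ g ∈ gapTuples k (r + 2), ∏ j, ((g j).factorial : ℝ) ≤ (r + 2).factorial * V ∧
      D * V / x ^ k ≤ overlapBound q δ β (β / x) n k := by
  have hq0 : (3 : ℝ) < q := by exact_mod_cast hq
  have hβ0 : 0 < β := by
    have h1 : (3 / q : ℝ) < 1 := by rw [div_lt_one (by linarith)]; exact hq0
    have h2 : 0 < (1 - 3 / q : ℝ)⁻¹ := inv_pos.2 (by linarith)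
    linarith
  have hρ0 : 0 < β / x := by positivity
  have hn0 : (0 : ℝ) < n := by
    have : 0 < n := by omega
    exact_mod_cast this
  have hs : n.sqrt * n.sqrt ≤ n := Nat.sqrt_le n
  have ha : 0 ≤ 8 / (n : ℝ) * ((k + 1) * (8 / 9) ^ k) := by positivity
  have hb : 0 ≤ ((n : ℝ) + 1) ^ (n.sqrt + 1) * (1 / 2) ^ (n / 16) := by positivity
  have hc : 0 ≤ (((n : ℝ) + 1) / δ) ^ q * β * (β / x) ^ n.sqrt := by positivity
  have hNn : (((r + 2 : ℕ) : ℝ)) ≤ n := by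
    refine Nat.cast_le.2 ?_
    omega
  by_cases hks : k ≤ n.sqrt
  · have hs4 : 4 ≤ n.sqrt := Nat.le_sqrt.2 (by omega)
    have h4 : 4 * k ≤ n := by nlinarith
    -- Few shared edges: the factor `x ^ k` is not needed, since `2/3 * 4/3 = 8/9 < 1`.
    refine ⟨(2 / 3) ^ k, _, ?_, sum_prod_factorial_le_of_pos hk, ?_⟩
    · have h := three_pow_mul_factorial_ratio_le (show k ≤ r by omega)
      have h' : (3 : ℝ) ^ k * ((2 * r).factorial * (r + k).factorial) ≤
          2 ^ k * (r.factorial * (2 * r + k).factorial) := by exact_mod_cast h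
      rw [div_pow, div_mul_eq_mul_div, le_div_iff₀ (by positivity)]
      linarith
    · have hxk : 1 ≤ x ^ k := one_le_pow₀ hx.le
      have hN : (n : ℝ) ≤ 2 * ((r + 2 : ℕ) : ℝ) := by
        have : n ≤ 2 * (r + 2) := by omega
        exact_mod_cast this
      have h1 : (2 / 3 : ℝ) ^ k * ((k + 1) * (4 / ((r + 2 : ℕ) : ℝ)) * (4 / 3) ^ k) ≤
          8 / n * ((k + 1) * (8 / 9) ^ k) := by
        have e : (8 / 9 : ℝ) ^ k = (2 / 3) ^ k * (4 / 3) ^ k := by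
          rw [← mul_pow]; norm_num
        have h2 : 4 / ((r + 2 : ℕ) : ℝ) ≤ 8 / n := by
          rw [div_le_div_iff₀ (by positivity) hn0]
          linarith
        calc _ = 4 / ((r + 2 : ℕ) : ℝ) * ((k + 1) * (8 / 9) ^ k) := by rw [e]; ring
          _ ≤ _ := by gcongr
      have h3 : (2 / 3 : ℝ) ^ k * ((((r + 2 : ℕ) : ℝ) + 1) ^ (k + 1) * (1 / 2) ^ ((r + 2) / 8)) ≤
          (n + 1) ^ (n.sqrt + 1) * (1 / 2) ^ (n / 16) := by
        have h5 : (2 / 3 : ℝ) ^ k ≤ 1 := pow_le_one₀ (by norm_num) (by norm_num)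
        have h6 : (((r + 2 : ℕ) : ℝ) + 1) ^ (k + 1) ≤ (n + 1) ^ (n.sqrt + 1) :=
          (pow_le_pow_left₀ (by positivity) (by linarith) _).trans
            (pow_le_pow_right₀ (by linarith) (by omega))
        have h7 : (1 / 2 : ℝ) ^ ((r + 2) / 8) ≤ (1 / 2) ^ (n / 16) :=
          pow_le_pow_of_le_one (by norm_num) (by norm_num) (by omega)
        refine (mul_le_of_le_one_left (by positivity) h5).trans ?_
        gcongr
      rw [div_le_iff₀ (by positivity), mul_add]
      refine le_trans ?_ (le_mul_of_one_le_right (by unfold overlapBound; positivity) hxk)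
      unfold overlapBound
      linarith
  -- Many shared edges: now `x ^ k` does the work against `β ^ (k + 1)`, and the trivial `D = 1`
  -- suffices.
  · refine ⟨1, _, ?_, sum_prod_factorial_le hq hδ0 hδ1, ?_⟩
    · rw [one_mul]
      exact_mod_cast factorial_ratio_le r k
    · rw [← hβ, one_mul]
      have h1 : (((r + 2 : ℕ) : ℝ) + 1) / δ ≤ (n + 1) / δ := by gcongr
      have h2 : (β / x) ^ k ≤ (β / x) ^ n.sqrt :=
        pow_le_pow_of_le_one hρ0.le ((div_le_one (by linarith)).2 hβx.le) (by omega)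
      calc ((((r + 2 : ℕ) : ℝ) + 1) / δ) ^ q * β ^ (k + 1) / x ^ k
          = ((((r + 2 : ℕ) : ℝ) + 1) / δ) ^ q * β * (β / x) ^ k := by
            rw [div_pow, pow_succ]; ring
        _ ≤ ((n + 1) / δ) ^ q * β * (β / x) ^ n.sqrt := by gcongr
        _ ≤ _ := by unfold overlapBound; linarith

/-! ### Asymptotics of the overlap bound -/

theorem tendsto_add_one_pow_mul_pow {ρ : ℝ} (h0 : 0 < ρ) (h1 : ρ < 1) (c : ℕ) :
    Tendsto (fun s : ℕ => ((s : ℝ) + 1) ^ c * ρ ^ s) atTop (𝓝 0) := by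
  have h := ((tendsto_add_atTop_iff_nat 1).2 (tendsto_pow_const_mul_const_pow_of_abs_lt_one c
    (abs_lt.2 ⟨by linarith, h1⟩))).mul_const ρ⁻¹
  rw [zero_mul] at h
  refine h.congr fun s => ?_
  push_cast
  rw [pow_succ]
  field_simp

theorem tendsto_nat_sqrt : Tendsto Nat.sqrt atTop atTop :=
  tendsto_atTop_atTop.2 fun b => ⟨b * b, fun _ h => Nat.le_sqrt.2 h⟩

theorem add_one_le_sqrt_sq (n : ℕ) : (n : ℝ) + 1 ≤ ((n.sqrt : ℝ) + 1) ^ 2 := by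
  have h : n + 1 ≤ (n.sqrt + 1) ^ 2 := by
    rw [sq]
    exact Nat.succ_le_succ_sqrt n
  exact_mod_cast h

/-- With `s = √n` rounded down, `n + 1 ≤ (s + 1) ^ 2` and `n ≥ s ^ 2` bound the expression by the
`s`-th power of `(s + 1) ^ 6 * (1/2) ^ (s / 16)`, a base that is eventually at most `1/2`. -/
theorem tendsto_mul_add_one_pow_sqrt :
    Tendsto (fun n : ℕ => (n : ℝ) * ((n + 1) ^ (n.sqrt + 1) * (1 / 2) ^ (n / 16))) atTop (𝓝 0) := by
  have h1 : Tendsto (fun s : ℕ => ((s : ℝ) + 1) ^ 6 * (1 / 2) ^ (s / 16)) atTop (𝓝 0) := by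
    have h := ((tendsto_add_one_pow_mul_pow (ρ := 1 / 2) (by norm_num) (by norm_num) 6).comp
      (Nat.tendsto_div_const_atTop (show 16 ≠ 0 by norm_num))).const_mul ((16 : ℝ) ^ 6)
    rw [mul_zero] at h
    refine squeeze_zero (fun s => by positivity) (fun s => ?_) h
    have h2 : (s : ℝ) + 1 ≤ 16 * (((s / 16 : ℕ) : ℝ) + 1) := by
      have : s + 1 ≤ 16 * (s / 16 + 1) := by omega
      exact_mod_cast this
    calc ((s : ℝ) + 1) ^ 6 * (1 / 2) ^ (s / 16)
        ≤ (16 * (((s / 16 : ℕ) : ℝ) + 1)) ^ 6 * (1 / 2) ^ (s / 16) := by gcongr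
      _ = _ := by simp only [Function.comp]; ring
  have h2 : Tendsto (fun n : ℕ => (1 / 2 : ℝ) ^ n.sqrt) atTop (𝓝 0) :=
    (tendsto_pow_atTop_nhds_zero_of_lt_one (by norm_num) (by norm_num)).comp tendsto_nat_sqrt
  refine squeeze_zero' (Eventually.of_forall fun n => by positivity) ?_ h2
  filter_upwards [tendsto_nat_sqrt.eventually
    (h1.eventually_le_const (show (0 : ℝ) < 1 / 2 by norm_num)),
    tendsto_nat_sqrt.eventually (eventually_ge_atTop 1)] with n hn hs
  set s := n.sqrt with hs'
  have hsn : s * s ≤ n := Nat.sqrt_le n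
  have hdiv : s * (s / 16) ≤ n / 16 := by
    rw [Nat.le_div_iff_mul_le (by norm_num)]
    calc s * (s / 16) * 16 = s * (s / 16 * 16) := by ring
      _ ≤ s * s := Nat.mul_le_mul_left _ (Nat.div_mul_le_self _ _)
      _ ≤ n := hsn
  have hn1 := add_one_le_sqrt_sq n
  rw [← hs'] at hn1
  have hs1 : (1 : ℝ) ≤ (s : ℝ) + 1 := by
    have : (0 : ℝ) ≤ s := Nat.cast_nonneg s
    linarith
  calc (n : ℝ) * ((n + 1) ^ (s + 1) * (1 / 2) ^ (n / 16))
      ≤ ((n : ℝ) + 1) * ((n + 1) ^ (s + 1) * (1 / 2) ^ (n / 16)) := by gcongr; linarith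
    _ = ((n : ℝ) + 1) ^ (s + 2) * (1 / 2) ^ (n / 16) := by ring
    _ ≤ (((s : ℝ) + 1) ^ 2) ^ (s + 2) * (1 / 2) ^ (s * (s / 16)) :=
      mul_le_mul (pow_le_pow_left₀ (by positivity) hn1 _)
        (pow_le_pow_of_le_one (by norm_num) (by norm_num) hdiv) (by positivity) (by positivity)
    _ = ((s : ℝ) + 1) ^ (2 * (s + 2)) * (1 / 2) ^ (s * (s / 16)) := by rw [← pow_mul]
    _ ≤ ((s : ℝ) + 1) ^ (6 * s) * (1 / 2) ^ (s * (s / 16)) := by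
      gcongr ?_ * _
      exact pow_le_pow_right₀ hs1 (by omega)
    _ = (((s : ℝ) + 1) ^ 6 * (1 / 2) ^ (s / 16)) ^ s := by
      rw [mul_pow, ← pow_mul, ← pow_mul, mul_comm s (s / 16)]
    _ ≤ _ := pow_le_pow_left₀ (by positivity) hn _

theorem tendsto_mul_pow_sqrt {δ β ρ : ℝ} (hδ : 0 < δ) (hβ : 0 < β) (hρ0 : 0 < ρ) (hρ1 : ρ < 1)
    (q : ℕ) :
    Tendsto (fun n : ℕ => (n : ℝ) * (((n + 1) / δ) ^ q * β * ρ ^ n.sqrt)) atTop (𝓝 0) := by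
  have h := ((tendsto_add_one_pow_mul_pow hρ0 hρ1 (2 * (q + 1))).comp
    tendsto_nat_sqrt).const_mul (β / δ ^ q)
  rw [mul_zero] at h
  refine squeeze_zero (fun n => by positivity) (fun n => ?_) h
  have hn := add_one_le_sqrt_sq n
  simp only [Function.comp]
  calc (n : ℝ) * (((n + 1) / δ) ^ q * β * ρ ^ n.sqrt)
      ≤ ((n : ℝ) + 1) * (((n + 1) / δ) ^ q * β * ρ ^ n.sqrt) := by gcongr; linarith
    _ = β / δ ^ q * (((n : ℝ) + 1) ^ (q + 1) * ρ ^ n.sqrt) := by rw [div_pow]; ring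
    _ ≤ β / δ ^ q * ((((n.sqrt : ℝ) + 1) ^ 2) ^ (q + 1) * ρ ^ n.sqrt) := by gcongr
    _ = _ := by rw [← pow_mul]

/-- The first term is `8 / n` times a term of a convergent series; the other two do not depend on
`k`, so summation costs them a factor of at most `n`. -/
theorem tendsto_sum_overlapBound {δ β ρ : ℝ} (hδ : 0 < δ) (hβ : 0 < β) (hρ0 : 0 < ρ) (hρ1 : ρ < 1)
    (q : ℕ) :
    Tendsto (fun n => ∑ k ∈ Icc 1 (n - 2), overlapBound q δ β ρ n k) atTop (𝓝 0) := by
  have hsummable : Summable fun k : ℕ => ((k : ℝ) + 1) * (8 / 9) ^ k := by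
    have h1 := summable_pow_mul_geometric_of_norm_lt_one 1 (r := (8 / 9 : ℝ)) (by norm_num)
    have h2 := summable_geometric_of_lt_one (r := (8 / 9 : ℝ)) (by norm_num) (by norm_num)
    refine (h1.add h2).congr fun k => ?_
    ring
  set M := ∑' k : ℕ, ((k : ℝ) + 1) * (8 / 9) ^ k with hM
  have h1 : Tendsto (fun n : ℕ => (8 : ℝ) / n * M) atTop (𝓝 0) := by
    simpa using (tendsto_const_div_atTop_nhds_zero_nat 8).mul_const M
  have h := (h1.add tendsto_mul_add_one_pow_sqrt).add (tendsto_mul_pow_sqrt hδ hβ hρ0 hρ1 q)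
  simp only [add_zero] at h
  refine squeeze_zero (fun n => sum_nonneg fun k _ => by unfold overlapBound; positivity)
    (fun n => ?_) h
  have hcard : (#(Icc 1 (n - 2)) : ℝ) ≤ n := by
    refine Nat.cast_le.2 ?_
    rw [Nat.card_Icc]
    omega
  simp only [overlapBound]
  rw [sum_add_distrib, sum_add_distrib, ← mul_sum, sum_const, sum_const, nsmul_eq_mul,
    nsmul_eq_mul]
  gcongr
  exact hsummable.sum_le_tsum _ fun k _ => by positivity

end HypercubeFPP

/-! ### The limit -/

theorem proposition4 {Ω : ℕ → Type*} [∀ n, MeasurableSpace (Ω n)]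
    (P : ∀ n, Measure (Ω n)) [∀ n, IsProbabilityMeasure (P n)]
    (ξ : ∀ n, (HypercubeFPP.hypercube n).edgeSet → Ω n → ℝ)
    (hlaw : ∀ n e, HasLaw (ξ n e) (expMeasure 1) (P n))
    (hindep : ∀ n, iIndepFun (ξ n) (P n))
    (ε C : ℝ) (hε : 0 < ε) (hC : 0 < C) :
    Tendsto
      (fun n => P n {ω | 0 < Set.ncard {π ∈ HypercubeFPP.connectingPaths C n |
        HypercubeFPP.middleWeight (fun e => ξ n e ω) π ≤ 1 + ε / 3}})
      atTop (𝓝 1) := by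
  classical
  set x := 1 + ε / 3 with hx
  have hx1 : 1 < x := by linarith
  have hx0 : 0 < x := by linarith
  obtain ⟨c, hc, hcard⟩ := HypercubeFPP.exists_mul_factorial_le_card_connectingPaths hC
  obtain ⟨q, δ, hq, hδ0, hδ1, hβ⟩ := HypercubeFPP.exists_inv_add_lt hx1
  set β := (1 - 3 / q : ℝ)⁻¹ + δ with hβ'
  have hq0 : (3 : ℝ) < q := by exact_mod_cast hq
  have hβ0 : 0 < β := by
    have h1 : (3 / q : ℝ) < 1 := by rw [div_lt_one (by linarith)]; exact hq0
    have h2 : 0 < (1 - 3 / q : ℝ)⁻¹ := inv_pos.2 (by linarith)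
    linarith
  have hlim := ((HypercubeFPP.tendsto_sum_overlapBound hδ0 hβ0 (div_pos hβ0 hx0)
    ((div_lt_one hx0).2 hβ) q).const_mul (c⁻¹ * Real.exp (2 * x)))
  have hlim' := ENNReal.tendsto_ofReal (hlim.const_sub 1)
  rw [mul_zero, sub_zero, ENNReal.ofReal_one] at hlim'
  refine tendsto_of_tendsto_of_tendsto_of_le_of_le' hlim' tendsto_const_nhds ?_
    (Eventually.of_forall fun n => prob_le_one)
  filter_upwards [hcard, eventually_ge_atTop 16] with n hT hn
  have : Fintype (HypercubeFPP.hypercube n).edgeSet := Fintype.ofFinite _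
  set T := Finset.univ.filter fun π => π ∈ HypercubeFPP.connectingPaths C n with hTdef
  -- The given weights are only almost everywhere measurable, so the estimate is made for the
  -- coordinate maps of the product space and transferred through the joint law.
  set μ := Measure.pi fun _ : (HypercubeFPP.hypercube n).edgeSet => expMeasure 1 with hμ
  set X : (HypercubeFPP.hypercube n).edgeSet → ((HypercubeFPP.hypercube n).edgeSet → ℝ) → ℝ :=
    fun e w => w e with hX
  have hXm : ∀ e, Measurable (X e) := fun e => measurable_pi_apply e
  have hXlaw : ∀ e, HasLaw (X e) (expMeasure 1) μ := fun e =>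
    (measurePreserving_eval
      (fun _ : (HypercubeFPP.hypercube n).edgeSet => expMeasure 1) e).hasLaw
  have hXind : iIndepFun X μ := iIndepFun_pi (X := fun _ => id) fun _ => aemeasurable_id
  have hbound := HypercubeFPP.measureReal_biInter_le (by omega) hXm hXlaw hXind hx0 hc T hT
    (HypercubeFPP.overlapBound q δ β (β / x) n) fun k r hkr hk =>
      HypercubeFPP.exists_overlap_bounds hx1 hq hδ0 hδ1 hβ' hβ hn hkr hk
  set B : Set ((HypercubeFPP.hypercube n).edgeSet → ℝ) :=
    ⋂ π ∈ T, {w | HypercubeFPP.middleWeight (fun e => X e w) π ≤ x}ᶜ with hB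
  have hBm : MeasurableSet B := by
    refine Finset.measurableSet_biInter _ fun π _ => MeasurableSet.compl ?_
    simp only [HypercubeFPP.middleWeight_eq]
    exact measurableSet_le (by fun_prop) (by fun_prop)
  have hmap : (P n).map (fun ω e => ξ n e ω) = μ := by
    rw [(hindep n).map_fun_eq_pi_map fun e => (hlaw n e).aemeasurable]
    simp only [(hlaw n _).map_eq, hμ]
  have hset : {ω | 0 < Set.ncard {π ∈ HypercubeFPP.connectingPaths C n |
      HypercubeFPP.middleWeight (fun e => ξ n e ω) π ≤ x}} = (fun ω e => ξ n e ω) ⁻¹' Bᶜ := by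
    ext ω
    rw [Set.mem_ofPred_eq, Set.ncard_pos (Set.toFinite _), Set.mem_preimage]
    simp only [hB, Set.mem_compl_iff, Set.mem_iInter, hTdef, Finset.mem_filter, Finset.mem_univ,
      true_and, hX]
    push Not
    rfl
  rw [hset, ← Measure.map_apply_of_aemeasurable
    (aemeasurable_pi_lambda _ fun e => (hlaw n e).aemeasurable) hBm.compl, hmap,
    ENNReal.ofReal_le_iff_le_toReal (measure_ne_top _ _)]
  have := probReal_compl_eq_one_sub (μ := μ) hBm
  rw [measureReal_def] at this
  rw [this]
  linarith
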